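/- Let $u_0:\mathbb R\to\mathbb R$ be of class $C^2$ and periodic with period $1$, and let $u$ be the $1$-periodic (in $x$) solution of $\partial_t u=\tfrac12\partial_{xx}u$ for $t\ge 0$ with $u(0,\cdot)=u_0$. Given $T>0$ and integers $M_S,M_T,N\ge1$, put $\delta x=1/M_S$, $\delta t=T/M_T$, $t_n=n\,\delta t$, $S=\{0,\dots,M_S-1\}$, $x_j=j\,\delta x$, and let $\phi_k$ ($k\in S$) be the continuous $1$-periodic function that is affine on every $[i\,\delta x,(i+1)\delta x]$, $i\in\mathbb Z$, and satisfies $\phi_k(x_j)=\delta_{kj}$ for $j\in S$. Let $(\mathcal N^{n,m,j})_{0\le n<M_T,\,1\le m\le N,\,j\in S}$ be independent standard Gaussian random variables. Define $u^0=v^0=(u_0(x_j))_{j\in S}$ and, for $0\le n<M_T$, $$u_j^{n+1}=\frac1N\sum_{m=1}^N\sum_{k\in S}u_k^n\,\phi_k\big(x_j+\sqrt{\delta t}\,\mathcal N^{n,m,j}\big),\qquad v_j^{n+1}=\sum_{k\in S}v_k^n\,\mathbb E\big[\phi_k\big(x_j+\sqrt{\delta t}\,\mathcal N\big)\big],$$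 with $\mathcal N$ a standard Gaussian variable. For $w\in\mathbb R^S$, extended by $w_{M_S}=w_0$, let $\|w\|_{\ell^2}^2=\delta x\sum_{j\in S}w_j^2$ and $|w|_{h^1}^2=\delta x\sum_{j\in S}\frac{(w_{j+1}-w_j)^2}{\delta x^2}$. For every $T>0$ the following hold. (i) There is a constant $C>0$, depending only on $T$, such that for all $u_0$, $M_S$, $M_T$ as above and all $0\le n\le M_T$, $$\sup_{j\in S}|u(t_n,x_j)-v_j^n|\le C\,\frac{\delta x^2}{\delta t}\,\sup_{x\in[0,1]}|u_0''(x)|.$$ (ii) For every integer $p\ge0$ there is a constant $C_p>0$, depending only on $p$ and $T$, such that for all $u_0$, $M_S$, $M_T$, $N$ as above and all $0\le n\le M_T$, $$\mathbb E\|u^n-v^n\|_{\ell^2}^2\le C_p\,|u^0|_{h^1}^2\Big(1+\frac{\delta x^2}{\delta t}\Big)\Big(1+\frac{\delta x}{\delta t}+\frac{\delta x^2}{\delta t^2}\big(1+|\log\delta t|\big)\Big)^p\Big(\frac{\delta t}{N}+\frac1{N^{p+1}}\Big).$$ -/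

import Mathlib

open MeasureTheory ProbabilityTheory
open scoped BigOperators

noncomputable section

namespace SemiLagrangian

/-- Classical `1`-periodic solutions of `∂ₜ u = ½ ∂ₓₓ u` on `[0, ∞) × ℝ` with `u(0, ·) = u₀`:
`u` is continuous up to time `0`, and for `t > 0` it is `C²` in space, differentiable in time,
and satisfies the equation. (Values at negative times are irrelevant.) -/
structure IsPeriodicHeatSolution (u₀ : ℝ → ℝ) (u : ℝ → ℝ → ℝ) : Prop where
  initial : ∀ x : ℝ, u 0 x = u₀ x
  periodic : ∀ t : ℝ, 0 ≤ t → Function.Periodic (u t) 1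
  continuousOn : ContinuousOn (fun q : ℝ × ℝ => u q.1 q.2) (Set.Ici (0 : ℝ) ×ˢ Set.univ)
  contDiff : ∀ t : ℝ, 0 < t → ContDiff ℝ 2 (u t)
  heat : ∀ t : ℝ, 0 < t → ∀ x : ℝ,
    HasDerivAt (fun s : ℝ => u s x) (1 / 2 * iteratedDeriv 2 (u t) x) t

/-- The mesh size `δx = 1 / M`. -/
def dx (M : ℕ) : ℝ := 1 / (M : ℝ)

/-- The time step `δt = T / MT`. -/
def dt (T : ℝ) (MT : ℕ) : ℝ := T / (MT : ℝ)

/-- The node `x_j = j δx`. -/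
def node {M : ℕ} (j : Fin M) : ℝ := (j : ℝ) * dx M

/-- The reference hat function: `1 - |x|` for `|x| ≤ 1`, and `0` for `|x| > 1`. -/
def hat (x : ℝ) : ℝ := if |x| ≤ 1 then 1 - |x| else 0

/-- The basis function `φ_k`: the `1`-periodization of `x ↦ hat ((x - x_k) / δx)`. It is the
periodic piecewise linear function on the grid with `φ_k (x_j) = δ_{kj}`. For every `x` only
finitely many terms are nonzero. -/
def phi {M : ℕ} (k : Fin M) (x : ℝ) : ℝ :=
  ∑' i : ℤ, hat ((x - node k - (i : ℝ)) / dx M)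

/-- The square of the discrete `L²` norm: `δx ∑_j u_j²`. -/
def ell2NormSq {M : ℕ} (u : Fin M → ℝ) : ℝ := dx M * ∑ j, u j ^ 2

/-- The square of the discrete `H¹` semi-norm: `δx ∑_j (u_{j+1} - u_j)² / δx²`.
Addition in `Fin M` is cyclic, which is the periodic extension `u_M = u_0`. -/
def h1SeminormSq {M : ℕ} [NeZero M] (u : Fin M → ℝ) : ℝ :=
  dx M * ∑ j, (u (j + 1) - u j) ^ 2 / dx M ^ 2

/-- The values of a function at the nodes. -/
def gridValues (M : ℕ) (f : ℝ → ℝ) : Fin M → ℝ := fun j => f (node j)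

/-- The Monte-Carlo scheme for given values `ξ n m j` of the noise:
`u_j^{n+1} = (1/N) ∑_m ∑_k u_k^n φ_k (x_j + √δt ξ^{n,m,j})`, started at `w`. -/
def mcScheme {M N : ℕ} (δt : ℝ) (w : Fin M → ℝ) (ξ : ℕ → Fin N → Fin M → ℝ) :
    ℕ → Fin M → ℝ
  | 0 => w
  | n + 1 => fun j =>
      1 / (N : ℝ) * ∑ m : Fin N, ∑ k : Fin M,
        mcScheme δt w ξ n k * phi k (node j + Real.sqrt δt * ξ n m j)

/-- The averaged scheme: `v_j^{n+1} = ∑_k v_k^n 𝔼[φ_k (x_j + √δt Z)]` with `Z` a standard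
Gaussian variable, started at `w`. -/
def meanScheme {M : ℕ} (δt : ℝ) (w : Fin M → ℝ) : ℕ → Fin M → ℝ
  | 0 => w
  | n + 1 => fun j =>
      ∑ k : Fin M, meanScheme δt w n k *
        ∫ z, phi k (node j + Real.sqrt δt * z) ∂(gaussianReal 0 1)

/-- The variables `ξ n m j`, for `n < MT`, `m < N`, `j < M`, are independent standard
Gaussian random variables (nothing is asked of the indices `n ≥ MT`, which the scheme does
not use up to step `MT`). -/
def IsGaussianNoise {Ω : Type*} [MeasurableSpace Ω] (P : Measure Ω) (MT : ℕ) {M N : ℕ}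
    (ξ : ℕ → Fin N → Fin M → Ω → ℝ) : Prop :=
  (∀ n : ℕ, n < MT → ∀ (m : Fin N) (j : Fin M), HasLaw (ξ n m j) (gaussianReal 0 1) P) ∧
  iIndepFun (fun (i : Fin MT × Fin N × Fin M) => ξ (i.1 : ℕ) i.2.1 i.2.2) P

end SemiLagrangian

end

/-!
The averaged scheme is the composition of piecewise linear interpolation with the exact heat
semigroup, sampled at the nodes. The solution of the heat equation is the Gaussian average
`gaussAvg u₀ t x = 𝔼[u₀ (x + √t Z)]`, by the maximum principle (`IsPeriodicHeatSolution.unique`).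
Each step therefore commits only the interpolation error, at most `δx² sup |u₀''|`, because the
averages have second derivatives bounded by `sup |u₀''|`. Averaged steps do not increase the maximum
norm, and there are at most `T / δt` of them. This bounds the error of the averaged scheme.

For the Monte-Carlo error, write `P` for the averaged step and `V (w)` for the sum over the nodes of
the variances of one sample `interp w (x_j + √δt Z)`. The sampling errors of different steps are orthogonal, and
those of different nodes are independent. Since `P` commutes with translations, the squared norm
`q_m = |P^m e_j|²` does not depend on `j`, and (`meanSqError_eq`)

  `𝔼 |u^n - v^n|² = (1/N) ∑_{l<n} q_{n-1-l} 𝔼 V (u^l)`.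

Three facts about these quantities are used.

* `V (w)` is at most `|w|² - |P w|²`, by Jensen's inequality, and at most
  `(δt / δx²) |∇w|²` with `|∇w|² = ∑_j (w_{j+1} - w_j)²`, because translates are Lipschitz in `ℓ²`. Splitting
  `u^l = v^l + (u^l - v^l)` gives `𝔼 V (u^l) ≤ 2 (δt / δx²) |∇v^l|² + 2 𝔼 |u^l - v^l|²`, where the
  gradient of `v^l` is controlled by that of `v^0`.
* The energy balance `𝔼 |u^{n+1}|² = 𝔼 |P u^n|² + (1/N) 𝔼 V (u^n)` and the first bound of `V` give
  `𝔼 |u^n - v^n|² ≤ (4/N) |u^0|²`. Subtracting a constant from `u^0` and using the Poincaré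
  inequality gives the case `p = 0`.
* `∑_{m<n} q_m` is at most `2 (T + 1) (1 + δx/δt + δx²/δt²)` (`sum_kernelSq_le_of_time`). If
  `δx² > δt`, this is the trivial bound by `n`. Otherwise, put `g = ∑_{m<n} P^{2m} e_0`, whose value
  at `0` is that sum. Pairing `g - P² g = e_0 - P^{2n} e_0` with `g` bounds the dissipation
  `|g|² - |P g|²` by `g_0`. The Cameron-Martin formula bounds the gradient of `P g` by that
  dissipation, the one-dimensional Sobolev inequality bounds the oscillation of `P g` by its
  gradient, and the average of `P g` is `n / M`. So `g_0` is bounded in terms of `√g_0`.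

Inserting a bound of the error of order `p` into the error formula gives the bound of order `p + 1`
(`meanSqError_le`).
-/

namespace SemiLagrangian

/-! ### Interpolation on the periodic grid -/

section Interpolation

variable {M : ℕ} [NeZero M]

/-- The residue class of `l` modulo `M`, as an element of `Fin M`. -/
def residue (M : ℕ) [NeZero M] (l : ℤ) : Fin M := l • (1 : Fin M)

theorem residue_add_one (l : ℤ) : residue M (l + 1) = residue M l + 1 := by
  simp [residue, add_zsmul]

theorem residue_add (l l' : ℤ) : residue M (l + l') = residue M l + residue M l' := by
  simp [residue, add_zsmul]

theorem val_nsmul_one (n : ℕ) : ((n • (1 : Fin M) : Fin M) : ℕ) = n % M := by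
  induction n with
  | zero => simp
  | succ n ih => rw [succ_nsmul, Fin.val_add, ih, Fin.val_one', ← Nat.add_mod]

theorem residue_eq_zero_iff (l : ℤ) : residue M l = 0 ↔ (M : ℤ) ∣ l := by
  have key : ∀ n : ℕ, n • (1 : Fin M) = 0 ↔ M ∣ n := fun n => by
    rw [← Fin.val_eq_zero_iff, val_nsmul_one, Nat.dvd_iff_mod_eq_zero]
  obtain ⟨n, rfl | rfl⟩ := l.eq_nat_or_neg
  · rw [residue, natCast_zsmul, key, Int.natCast_dvd_natCast]
  · rw [residue, neg_zsmul, neg_eq_zero, natCast_zsmul, key, Int.dvd_neg, Int.natCast_dvd_natCast]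

theorem residue_val (k : Fin M) : residue M (k : ℕ) = k := by
  rw [residue, natCast_zsmul]
  exact Fin.ext (by rw [val_nsmul_one, Nat.mod_eq_of_lt k.2])

theorem residue_eq_iff (l : ℤ) (k : Fin M) : residue M l = k ↔ (M : ℤ) ∣ l - (k : ℕ) := by
  rw [← residue_eq_zero_iff, sub_eq_add_neg, residue_add, ← sub_eq_zero]
  conv_lhs => rw [← residue_val k]
  simp [residue, sub_eq_add_neg]

theorem gridSize_pos : (0 : ℝ) < M := Nat.cast_pos.2 (NeZero.pos M)

theorem dx_pos : 0 < dx M := by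
  have := gridSize_pos (M := M)
  unfold dx; positivity

theorem dx_mul : (M : ℝ) * dx M = 1 := by
  have := gridSize_pos (M := M)
  unfold dx; field_simp

/-- The node of a residue class differs from `l δx` by a period. -/
theorem exists_node_residue (l : ℤ) : ∃ i : ℤ, node (residue M l) = l * dx M + i := by
  obtain ⟨i, hi⟩ := (residue_eq_iff l (residue M l)).1 rfl
  refine ⟨-i, ?_⟩
  have h : (l : ℝ) - ((residue M l : Fin M) : ℕ) = M * i := by exact_mod_cast hi
  have := dx_mul (M := M)
  rw [node, show (((residue M l : Fin M) : ℕ) : ℝ) = l - M * i by linarith, Int.cast_neg]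
  linear_combination (-(i : ℝ)) * this

theorem hat_intCast_add (a : ℤ) {θ : ℝ} (h0 : 0 ≤ θ) (h1 : θ < 1) :
    hat (a + θ) = (if a = 0 then 1 - θ else 0) + if a = -1 then θ else 0 := by
  unfold hat
  rcases lt_trichotomy a (-1) with h | rfl | h
  · have h' : (a : ℝ) ≤ -2 := by exact_mod_cast (by omega : a ≤ -2)
    rw [if_neg (by rw [abs_of_neg (by linarith)]; linarith), if_neg (by omega), if_neg (by omega)]
    simp
  · push_cast
    rw [abs_of_neg (by linarith), if_pos (by linarith)]
    norm_num
  · rcases (by omega : 0 ≤ a).eq_or_lt with rfl | h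
    · push_cast
      rw [zero_add, abs_of_nonneg h0, if_pos h1.le]
      norm_num
    · have h' : (1 : ℝ) ≤ a := by exact_mod_cast h
      rw [if_neg (show a ≠ 0 by omega), if_neg (show a ≠ -1 by omega),
        abs_of_nonneg (by linarith)]
      split_ifs with h2
      · have : (a : ℝ) + θ = 1 := by linarith
        simp [this]
      · simp

theorem hat_neg (x : ℝ) : hat (-x) = hat x := by simp [hat]

theorem tsum_ite_eq_mul (a : ℤ) (c : ℝ) :
    (Summable fun i : ℤ => if a = M * i then c else 0) ∧
      ∑' i : ℤ, (if a = M * i then c else 0) = if (M : ℤ) ∣ a then c else 0 := by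
  have hM : (M : ℤ) ≠ 0 := by exact_mod_cast NeZero.ne M
  by_cases h : (M : ℤ) ∣ a
  · obtain ⟨b, rfl⟩ := h
    have : (fun i : ℤ => if (M : ℤ) * b = M * i then c else 0) =
        fun i => if i = b then c else 0 := by
      funext i
      simp only [mul_right_inj' hM, eq_comm]
    rw [this]
    exact ⟨(hasSum_ite_eq b c).summable, by simp⟩
  · have : (fun i : ℤ => if a = M * i then c else 0) = fun _ => 0 := by
      funext i
      rw [if_neg]
      rintro rfl
      exact h (dvd_mul_right _ _)
    rw [this, if_neg h]
    exact ⟨summable_zero, tsum_zero⟩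

/-- On the cell `[l δx, (l + 1) δx)` the only basis functions that do not vanish are those of the
two end points, and there they are affine. -/
theorem phi_apply (k : Fin M) (l : ℤ) {θ : ℝ} (h0 : 0 ≤ θ) (h1 : θ < 1) :
    phi k ((l + θ) * dx M) =
      (1 - θ) * (if residue M l = k then 1 else 0) +
        θ * (if residue M (l + 1) = k then 1 else 0) := by
  have hd := dx_pos (M := M)
  have hm := dx_mul (M := M)
  have key : ∀ i : ℤ, hat (((l + θ) * dx M - node k - (i : ℝ)) / dx M) =
      (if l - (k : ℕ) = M * i then 1 - θ else 0) + if l + 1 - (k : ℕ) = M * i then θ else 0 := by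
    intro i
    have : ((l + θ) * dx M - node k - (i : ℝ)) / dx M = ((l - (k : ℕ) - M * i : ℤ) : ℝ) + θ := by
      rw [div_eq_iff hd.ne', node]
      push_cast
      linear_combination (-(i : ℝ)) * (-hm)
    rw [this, hat_intCast_add _ h0 h1]
    congr 1
    · simp only [sub_eq_zero]
    · refine if_congr ?_ rfl rfl
      omega
  have h2 := tsum_ite_eq_mul (M := M) (l - (k : ℕ)) (1 - θ)
  have h3 := tsum_ite_eq_mul (M := M) (l + 1 - (k : ℕ)) θ
  rw [phi, tsum_congr key, h2.1.tsum_add h3.1, h2.2, h3.2]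
  simp only [residue_eq_iff, mul_ite, mul_one, mul_zero]

/-- The periodic piecewise linear function with values `w` at the nodes. -/
noncomputable def interp {M : ℕ} (w : Fin M → ℝ) (x : ℝ) : ℝ := ∑ k, w k * phi k x

/-- Every point is `(l + θ) δx` with `l` an integer and `0 ≤ θ < 1`. -/
theorem exists_cell (M : ℕ) [NeZero M] (x : ℝ) :
    ∃ (l : ℤ) (θ : ℝ), 0 ≤ θ ∧ θ < 1 ∧ x = (l + θ) * dx M :=
  ⟨⌊M * x⌋, Int.fract (M * x), Int.fract_nonneg _, Int.fract_lt_one _, by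
    rw [Int.floor_add_fract]; linear_combination -x * dx_mul (M := M)⟩

theorem interp_apply (w : Fin M → ℝ) (l : ℤ) {θ : ℝ} (h0 : 0 ≤ θ) (h1 : θ < 1) :
    interp w ((l + θ) * dx M) = (1 - θ) * w (residue M l) + θ * w (residue M (l + 1)) := by
  simp only [interp, phi_apply _ l h0 h1, mul_add, Finset.sum_add_distrib]
  simp [mul_comm]

theorem phi_nonneg (k : Fin M) (x : ℝ) : 0 ≤ phi k x := by
  obtain ⟨l, θ, h0, h1, rfl⟩ := exists_cell M x
  rw [phi_apply k l h0 h1]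
  have : 0 ≤ 1 - θ := by linarith
  positivity

theorem sum_phi (x : ℝ) : ∑ k : Fin M, phi k x = 1 := by
  obtain ⟨l, θ, h0, h1, rfl⟩ := exists_cell M x
  simpa [interp] using interp_apply (M := M) (fun _ => 1) l h0 h1

theorem phi_le_one (k : Fin M) (x : ℝ) : phi k x ≤ 1 :=
  sum_phi (M := M) x ▸ Finset.single_le_sum (fun i _ => phi_nonneg i x) (Finset.mem_univ k)

theorem measurable_phi (k : Fin M) : Measurable (phi k) := by
  have : phi k = fun x : ℝ => (1 - Int.fract (M * x)) * (if residue M ⌊M * x⌋ = k then 1 else 0) +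
      Int.fract (M * x) * (if residue M (⌊M * x⌋ + 1) = k then 1 else 0) := by
    funext x
    rw [← phi_apply k ⌊M * x⌋ (Int.fract_nonneg _) (Int.fract_lt_one _), Int.floor_add_fract]
    congr 1
    linear_combination -x * dx_mul (M := M)
  rw [this]
  have hf : Measurable fun x : ℝ => ⌊M * x⌋ := (measurable_const.mul measurable_id).floor
  have hg : Measurable fun x : ℝ => Int.fract (M * x) := (measurable_const.mul measurable_id).fract
  refine ((measurable_const.sub hg).mul ?_).add (hg.mul ?_)
  · exact (measurable_of_countable fun l : ℤ => if residue M l = k then (1 : ℝ) else 0).comp hf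
  · exact (measurable_of_countable
      fun l : ℤ => if residue M (l + 1) = k then (1 : ℝ) else 0).comp hf

theorem measurable_interp (w : Fin M → ℝ) : Measurable (interp w) :=
  Finset.measurable_sum _ fun k _ => (measurable_phi k).const_mul _

theorem phi_add_intCast {M : ℕ} (k : Fin M) (x : ℝ) (i : ℤ) : phi k (x + i) = phi k x := by
  unfold phi
  rw [← (Equiv.addRight i).tsum_eq]
  refine tsum_congr fun a => ?_
  simp only [Equiv.coe_addRight, Int.cast_add]
  congr 2
  ring

theorem interp_add_intCast {M : ℕ} (w : Fin M → ℝ) (x : ℝ) (i : ℤ) :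
    interp w (x + i) = interp w x := by
  simp only [interp, phi_add_intCast]

theorem interp_node_residue_add (w : Fin M → ℝ) (l : ℤ) (y : ℝ) :
    interp w (node (residue M l) + y) = interp w (l * dx M + y) := by
  obtain ⟨i, hi⟩ := exists_node_residue (M := M) l
  rw [hi, add_right_comm, interp_add_intCast]

theorem interp_node_add_one (w : Fin M → ℝ) (j : Fin M) (y : ℝ) :
    interp w (node (j + 1) + y) = interp w (node j + dx M + y) := by
  have h : j + 1 = residue M ((j : ℕ) + 1) := by rw [residue_add_one, residue_val]
  rw [h, interp_node_residue_add, node]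
  congr 1
  push_cast
  ring

theorem interp_shift (w : Fin M → ℝ) (x : ℝ) :
    interp (fun k => w (k + 1)) x = interp w (x + dx M) := by
  obtain ⟨l, θ, h0, h1, rfl⟩ := exists_cell M x
  rw [interp_apply _ l h0 h1,
    show ((l : ℝ) + θ) * dx M + dx M = (((l + 1 : ℤ) : ℝ) + θ) * dx M by push_cast; ring,
    interp_apply _ (l + 1) h0 h1]
  simp only [residue_add_one]

/-- Symmetry of the basis functions, because the hat function is even. -/
theorem phi_symm {M : ℕ} (j k : Fin M) (y : ℝ) : phi k (node j + y) = phi j (node k - y) := by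
  unfold phi
  rw [← (Equiv.neg ℤ).tsum_eq]
  refine tsum_congr fun a => ?_
  rw [← hat_neg]
  simp only [Equiv.neg_apply, Int.cast_neg]
  congr 1
  ring

theorem abs_interp_le {w : Fin M → ℝ} {R : ℝ} (h : ∀ k, |w k| ≤ R) (x : ℝ) : |interp w x| ≤ R := by
  calc |interp w x| ≤ ∑ k, |w k * phi k x| := Finset.abs_sum_le_sum_abs _ _
    _ ≤ ∑ k, R * phi k x := Finset.sum_le_sum fun k _ => by
        rw [abs_mul, abs_of_nonneg (phi_nonneg k x)]
        exact mul_le_mul_of_nonneg_right (h k) (phi_nonneg k x)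
    _ = R := by rw [← Finset.mul_sum, sum_phi, mul_one]

/-- Jensen's inequality for the convex combination `interp`. -/
theorem interp_sq_le (w : Fin M → ℝ) (x : ℝ) :
    interp w x ^ 2 ≤ interp (fun k => w k ^ 2) x := by
  have h := Finset.sum_sq_le_sum_mul_sum_of_sq_le_mul Finset.univ (r := fun k => w k * phi k x)
    (f := fun k => w k ^ 2 * phi k x) (g := fun k => phi k x)
    (fun k _ => mul_nonneg (sq_nonneg _) (phi_nonneg k x)) (fun k _ => phi_nonneg k x)
    (fun k _ => by rw [mul_pow, sq (phi k x), mul_assoc])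
  rwa [sum_phi, mul_one] at h

theorem interp_add {M : ℕ} (v w : Fin M → ℝ) (x : ℝ) :
    interp (v + w) x = interp v x + interp w x := by
  simp [interp, add_mul, Finset.sum_add_distrib]

theorem interp_sub {M : ℕ} (v w : Fin M → ℝ) (x : ℝ) :
    interp (v - w) x = interp v x - interp w x := by
  simp [interp, sub_mul, Finset.sum_sub_distrib]

theorem interp_const (c x : ℝ) : interp (fun _ : Fin M => c) x = c := by
  rw [interp, ← Finset.mul_sum, sum_phi, mul_one]

theorem sum_comp_add_residue (f : Fin M → ℝ) (l : ℤ) : ∑ j, f (j + residue M l) = ∑ j, f j :=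
  Equiv.sum_comp (Equiv.addRight (residue M l)) f

theorem sum_comp_add_one (f : Fin M → ℝ) : ∑ j, f (j + 1) = ∑ j, f j :=
  Equiv.sum_comp (Equiv.addRight (1 : Fin M)) f

end Interpolation

/-! ### The averaged step and the variance of one Monte-Carlo sample -/

section AveragedStep

theorem memLp_two_of_bounded {Ω : Type*} [MeasurableSpace Ω] {P : Measure Ω} [IsFiniteMeasure P]
    {f : Ω → ℝ} (hf : Measurable f) {R : ℝ} (h : ∀ ω, |f ω| ≤ R) : MemLp f 2 P :=
  MemLp.of_bound hf.aestronglyMeasurable R (Filter.Eventually.of_forall h)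

variable {M : ℕ} [NeZero M]

theorem exists_abs_le {ι : Type*} [Finite ι] (w : ι → ℝ) : ∃ R, ∀ k, |w k| ≤ R := by
  obtain ⟨R, hR⟩ := (Set.finite_range fun k => |w k|).bddAbove
  exact ⟨R, fun k => hR ⟨k, rfl⟩⟩

theorem measurable_interp_affine (w : Fin M → ℝ) (x s : ℝ) :
    Measurable fun z : ℝ => interp w (x + s * z) :=
  (measurable_interp w).comp (by fun_prop)

theorem memLp_interp (w : Fin M → ℝ) (x s : ℝ) :
    MemLp (fun z : ℝ => interp w (x + s * z)) 2 (gaussianReal 0 1) := by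
  obtain ⟨R, hR⟩ := exists_abs_le w
  exact memLp_two_of_bounded (measurable_interp_affine w x s) fun z => abs_interp_le hR _

theorem integrable_interp (w : Fin M → ℝ) (x s : ℝ) :
    Integrable (fun z : ℝ => interp w (x + s * z)) (gaussianReal 0 1) :=
  (memLp_interp w x s).integrable one_le_two

theorem integrable_phi (k : Fin M) (x s : ℝ) :
    Integrable (fun z : ℝ => phi k (x + s * z)) (gaussianReal 0 1) :=
  (memLp_two_of_bounded ((measurable_phi k).comp (by fun_prop)) (R := 1) fun z => by
    rw [Function.comp, abs_of_nonneg (phi_nonneg k _)]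
    exact phi_le_one k _).integrable one_le_two

/-- One step of the averaged scheme, with noise of standard deviation `s`. -/
noncomputable def avgStep {M : ℕ} (s : ℝ) : (Fin M → ℝ) →ₗ[ℝ] (Fin M → ℝ) where
  toFun w j := ∑ k, w k * ∫ z, phi k (node j + s * z) ∂(gaussianReal 0 1)
  map_add' v w := by
    funext j
    simp [add_mul, Finset.sum_add_distrib]
  map_smul' c w := by
    funext j
    simp [Finset.mul_sum, mul_assoc]

theorem avgStep_apply (s : ℝ) (w : Fin M → ℝ) (j : Fin M) :
    avgStep s w j = ∫ z, interp w (node j + s * z) ∂(gaussianReal 0 1) := by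
  simp only [interp]
  rw [integral_finsetSum _ fun k _ => (integrable_phi k _ _).const_mul _]
  simp only [integral_const_mul]
  rfl

theorem avgStep_nonneg (s : ℝ) {w : Fin M → ℝ} (hw : ∀ k, 0 ≤ w k) (j : Fin M) :
    0 ≤ avgStep s w j := by
  rw [avgStep_apply]
  exact integral_nonneg fun z => Finset.sum_nonneg fun k _ => mul_nonneg (hw k) (phi_nonneg k _)

theorem avgStep_const (s c : ℝ) : avgStep s (fun _ : Fin M => c) = fun _ => c := by
  funext j
  simp [avgStep_apply, interp_const]

theorem integral_gaussianReal_comp_neg (f : ℝ → ℝ) :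
    ∫ z, f (-z) ∂(gaussianReal 0 1) = ∫ z, f z ∂(gaussianReal 0 1) := by
  conv_rhs => rw [← neg_zero, ← gaussianReal_map_neg]
  exact ((MeasurableEquiv.neg ℝ).measurableEmbedding.integral_map f).symm

/-- The averaged step is symmetric, because both the basis functions and the noise are even. -/
theorem dotProduct_avgStep {M : ℕ} (s : ℝ) (v w : Fin M → ℝ) :
    v ⬝ᵥ avgStep s w = avgStep s v ⬝ᵥ w := by
  have h : ∀ j k : Fin M, ∫ z, phi k (node j + s * z) ∂(gaussianReal 0 1) =
      ∫ z, phi j (node k + s * z) ∂(gaussianReal 0 1) := fun j k => by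
    rw [← integral_gaussianReal_comp_neg]
    refine integral_congr_ae (Filter.Eventually.of_forall fun z => ?_)
    simp only [phi_symm j k, mul_neg, sub_neg_eq_add]
  simp only [dotProduct, avgStep, LinearMap.coe_mk, AddHom.coe_mk, Finset.mul_sum, Finset.sum_mul]
  rw [Finset.sum_comm]
  refine Finset.sum_congr rfl fun k _ => Finset.sum_congr rfl fun j _ => ?_
  rw [h j k]
  ring

theorem sum_avgStep (s : ℝ) (w : Fin M → ℝ) : ∑ j, avgStep s w j = ∑ j, w j := by
  have h := dotProduct_avgStep s (fun _ => 1) w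
  rw [avgStep_const] at h
  simpa [dotProduct] using h

/-- The cyclic shift of grid functions. -/
def shift : (Fin M → ℝ) →ₗ[ℝ] (Fin M → ℝ) := LinearMap.funLeft ℝ ℝ (· + 1)

theorem shift_apply (w : Fin M → ℝ) (j : Fin M) : shift w j = w (j + 1) := rfl

theorem avgStep_shift (s : ℝ) (w : Fin M → ℝ) : avgStep s (shift w) = shift (avgStep s w) := by
  funext j
  rw [shift_apply, avgStep_apply, avgStep_apply]
  refine integral_congr_ae (Filter.Eventually.of_forall fun z => ?_)
  simp only
  rw [interp_node_add_one, ← add_right_comm]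
  exact interp_shift w _

/-- The variance of one Monte-Carlo sample `interp w (x_j + s Z)`. -/
noncomputable def sampleVar {M : ℕ} (s : ℝ) (w : Fin M → ℝ) (j : Fin M) : ℝ :=
  Var[fun z => interp w (node j + s * z); gaussianReal 0 1]

theorem sampleVar_nonneg {M : ℕ} (s : ℝ) (w : Fin M → ℝ) (j : Fin M) : 0 ≤ sampleVar s w j :=
  variance_nonneg _ _

theorem sampleVar_eq (s : ℝ) (w : Fin M → ℝ) (j : Fin M) :
    sampleVar s w j =
      ∫ z, interp w (node j + s * z) ^ 2 ∂(gaussianReal 0 1) - avgStep s w j ^ 2 := by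
  rw [sampleVar, variance_eq_sub (memLp_interp w _ s), avgStep_apply]
  rfl

theorem sampleVar_add_le (s : ℝ) (v w : Fin M → ℝ) (j : Fin M) :
    sampleVar s (v + w) j ≤ 2 * sampleVar s v j + 2 * sampleVar s w j := by
  have hv := memLp_interp v (node j) s
  have hw := memLp_interp w (node j) s
  have h1 := variance_fun_add hv hw
  have h2 := variance_fun_sub hv hw
  have h3 := variance_nonneg
    (fun z => interp v (node j + s * z) - interp w (node j + s * z)) (gaussianReal 0 1)
  simp only [sampleVar, interp_add]
  linarith

theorem sampleVar_le_integral_sub_sq (s : ℝ) (w : Fin M → ℝ) (j : Fin M) (c : ℝ) :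
    sampleVar s w j ≤ ∫ z, (interp w (node j + s * z) - c) ^ 2 ∂(gaussianReal 0 1) := by
  have hm := (measurable_interp_affine w (node j) s).aestronglyMeasurable (μ := gaussianReal 0 1)
  rw [sampleVar, ← variance_sub_const hm c]
  exact variance_le_expectation_sq (hm.sub aestronglyMeasurable_const)

/-- By Jensen's inequality for the convex combination `interp`, the total sampling variance is at
most what the averaged step dissipates. -/
theorem sum_sampleVar_le (s : ℝ) (w : Fin M → ℝ) :
    ∑ j, sampleVar s w j ≤ w ⬝ᵥ w - avgStep s w ⬝ᵥ avgStep s w := by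
  have h : ∀ j, sampleVar s w j ≤ avgStep s (fun k => w k ^ 2) j - avgStep s w j ^ 2 := fun j => by
    rw [sampleVar_eq, avgStep_apply s fun k => w k ^ 2]
    exact sub_le_sub_right (integral_mono (memLp_interp w _ s).integrable_sq
      (integrable_interp _ _ s) fun z => interp_sq_le w _) _
  refine (Finset.sum_le_sum fun j _ => h j).trans_eq ?_
  rw [Finset.sum_sub_distrib, sum_avgStep]
  simp [dotProduct, sq]

theorem avgStep_contraction (s : ℝ) (w : Fin M → ℝ) :
    avgStep s w ⬝ᵥ avgStep s w ≤ w ⬝ᵥ w := by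
  have := sum_sampleVar_le s w
  have := Finset.sum_nonneg fun j (_ : j ∈ Finset.univ) => sampleVar_nonneg s w j
  linarith

theorem dotProduct_self_nonneg' {ι : Type*} [Fintype ι] (w : ι → ℝ) : 0 ≤ w ⬝ᵥ w :=
  Finset.sum_nonneg fun _ _ => mul_self_nonneg _

theorem sum_sampleVar_le_self (s : ℝ) (w : Fin M → ℝ) : ∑ j, sampleVar s w j ≤ w ⬝ᵥ w :=
  (sum_sampleVar_le s w).trans (sub_le_self _ (dotProduct_self_nonneg' _))

/-- The squared differences of neighbouring values, `∑_j (w_{j+1} - w_j)²`. -/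
def gradSq (w : Fin M → ℝ) : ℝ := (shift w - w) ⬝ᵥ (shift w - w)

theorem gradSq_nonneg (w : Fin M → ℝ) : 0 ≤ gradSq w := dotProduct_self_nonneg' _

theorem gradSq_avgStep_le (s : ℝ) (w : Fin M → ℝ) : gradSq (avgStep s w) ≤ gradSq w := by
  unfold gradSq
  rw [← avgStep_shift, ← map_sub]
  exact avgStep_contraction s _

theorem gradSq_eq_sum (w : Fin M → ℝ) : gradSq w = ∑ j, (w (j + 1) - w j) ^ 2 := by
  simp [gradSq, dotProduct, shift_apply, sq]

/-- A shift by `i` steps costs at most `i²` times the energy of one step. -/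
theorem sum_sub_sq_le_nat (w : Fin M → ℝ) (i : ℕ) :
    ∑ j, (w (j + residue M i) - w j) ^ 2 ≤ (i : ℝ) ^ 2 * gradSq w := by
  have hr : ∀ (j : Fin M), w (j + residue M i) - w j =
      ∑ a ∈ Finset.range i, (w (j + residue M a + 1) - w (j + residue M a)) := fun j => by
    have h := Finset.sum_range_sub (fun a : ℕ => w (j + residue M a)) i
    simp only [Nat.cast_add, Nat.cast_one, residue_add_one, ← add_assoc] at h
    rw [h]
    simp [residue]
  calc ∑ j, (w (j + residue M i) - w j) ^ 2
      ≤ ∑ j, (i : ℝ) * ∑ a ∈ Finset.range i,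
          (w (j + residue M a + 1) - w (j + residue M a)) ^ 2 := by
        refine Finset.sum_le_sum fun j _ => ?_
        rw [hr j]
        simpa using sq_sum_le_card_mul_sum_sq (s := Finset.range i)
          (f := fun a : ℕ => w (j + residue M a + 1) - w (j + residue M a))
    _ = (i : ℝ) ^ 2 * gradSq w := by
        rw [← Finset.mul_sum, Finset.sum_comm]
        have h : ∀ a ∈ Finset.range i,
            ∑ j, (w (j + residue M a + 1) - w (j + residue M a)) ^ 2 = gradSq w := fun a _ => by
          rw [gradSq_eq_sum]
          exact sum_comp_add_residue (fun j => (w (j + 1) - w j) ^ 2) a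
        rw [Finset.sum_congr rfl h]
        simp
        ring

theorem sum_sub_sq_le_int (w : Fin M → ℝ) (i : ℤ) :
    ∑ j, (w (j + residue M i) - w j) ^ 2 ≤ (i : ℝ) ^ 2 * gradSq w := by
  obtain ⟨n, rfl | rfl⟩ := i.eq_nat_or_neg
  · exact_mod_cast sum_sub_sq_le_nat w n
  · have h := sum_comp_add_residue (fun j => (w (j + residue M (-(n : ℤ))) - w j) ^ 2) n
    have h0 : residue M (n : ℤ) + residue M (-(n : ℤ)) = 0 := by simp [residue]
    simp only [add_assoc, h0, add_zero] at h
    rw [← h]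
    have := sum_sub_sq_le_nat w n
    push_cast
    rw [neg_sq]
    refine le_of_eq_of_le (Finset.sum_congr rfl fun j _ => ?_) this
    ring

/-- A grid function has Lipschitz translates in `ℓ²`, with constant its discrete `H¹`
semi-norm. -/
theorem sum_interp_sub_sq_le (w : Fin M → ℝ) (y : ℝ) :
    ∑ j, (interp w (node j + y) - w j) ^ 2 ≤ (y / dx M) ^ 2 * gradSq w := by
  obtain ⟨i, θ, h0, h1, rfl⟩ := exists_cell M y
  have hd := dx_pos (M := M)
  have hG := gradSq_nonneg w
  rw [mul_div_cancel_right₀ _ hd.ne']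
  have hpt : ∀ j, (interp w (node j + (i + θ) * dx M) - w j) =
      (1 - θ) * (w (j + residue M i) - w j) + θ * (w (j + residue M (i + 1)) - w j) := fun j => by
    have : node j + (i + θ) * dx M = (((j : ℕ) + i : ℤ) + θ) * dx M := by
      rw [node]; push_cast; ring
    rw [this, interp_apply _ _ h0 h1, add_assoc, residue_add, residue_val, residue_add _ (i + 1),
      residue_val]
    ring
  set a : Fin M → ℝ := fun j => w (j + residue M i) - w j with ha
  set b : Fin M → ℝ := fun j => w (j + residue M (i + 1)) - w j with hb
  have hA : ∑ j, a j ^ 2 ≤ (i : ℝ) ^ 2 * gradSq w := sum_sub_sq_le_int w i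
  have hB : ∑ j, b j ^ 2 ≤ ((i : ℝ) + 1) ^ 2 * gradSq w := by
    exact_mod_cast sum_sub_sq_le_int w (i + 1)
  -- The integers `i` and `i + 1` have the same sign, so the triangle inequality is sharp.
  have hsign : 0 ≤ (i : ℝ) * (i + 1) := by
    rcases le_or_gt 0 i with h | h
    · have : (0 : ℝ) ≤ i := by exact_mod_cast h
      positivity
    · have : (i : ℝ) ≤ -1 := by exact_mod_cast (by omega : i ≤ -1)
      nlinarith
  have hAB : ∑ j, a j * b j ≤ (i : ℝ) * (i + 1) * gradSq w := by
    have hcs := Finset.sum_mul_sq_le_sq_mul_sq Finset.univ a b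
    refine abs_le_of_sq_le_sq' ?_ (mul_nonneg hsign hG) |>.2
    calc (∑ j, a j * b j) ^ 2 ≤ (∑ j, a j ^ 2) * ∑ j, b j ^ 2 := hcs
      _ ≤ ((i : ℝ) ^ 2 * gradSq w) * (((i : ℝ) + 1) ^ 2 * gradSq w) :=
        mul_le_mul hA hB (Finset.sum_nonneg fun _ _ => sq_nonneg _) (by positivity)
      _ = _ := by ring
  calc ∑ j, (interp w (node j + (i + θ) * dx M) - w j) ^ 2
      = (1 - θ) ^ 2 * ∑ j, a j ^ 2 + 2 * ((1 - θ) * θ) * ∑ j, a j * b j +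
          θ ^ 2 * ∑ j, b j ^ 2 := by
        simp only [hpt, Finset.mul_sum, ← Finset.sum_add_distrib]
        exact Finset.sum_congr rfl fun j _ => by ring
    _ ≤ (1 - θ) ^ 2 * ((i : ℝ) ^ 2 * gradSq w) +
          2 * ((1 - θ) * θ) * ((i : ℝ) * (i + 1) * gradSq w) +
          θ ^ 2 * (((i : ℝ) + 1) ^ 2 * gradSq w) := by
        have : 0 ≤ 1 - θ := by linarith
        gcongr
    _ = (i + θ) ^ 2 * gradSq w := by ring

theorem integral_sq_gaussianReal : ∫ z, z ^ 2 ∂(gaussianReal 0 1) = 1 := by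
  have h := variance_eq_sub (memLp_id_gaussianReal (μ := 0) (v := 1) 2)
  rw [variance_id_gaussianReal] at h
  simpa [integral_id_gaussianReal] using h.symm

theorem integrable_sq_gaussianReal : Integrable (fun z : ℝ => z ^ 2) (gaussianReal 0 1) :=
  (memLp_id_gaussianReal (μ := 0) (v := 1) 2).integrable_sq

/-- The total sampling variance of a grid function is at most `s²` times its squared discrete
`H¹` semi-norm. -/
theorem sum_sampleVar_le_gradSq (s : ℝ) (w : Fin M → ℝ) :
    ∑ j, sampleVar s w j ≤ s ^ 2 / dx M ^ 2 * gradSq w := by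
  have hi : ∀ j, Integrable (fun z => (interp w (node j + s * z) - w j) ^ 2) (gaussianReal 0 1) :=
    fun j => ((memLp_interp w _ s).sub (memLp_const (w j))).integrable_sq
  calc ∑ j, sampleVar s w j
      ≤ ∑ j, ∫ z, (interp w (node j + s * z) - w j) ^ 2 ∂(gaussianReal 0 1) :=
        Finset.sum_le_sum fun j _ => sampleVar_le_integral_sub_sq s w j _
    _ = ∫ z, ∑ j, (interp w (node j + s * z) - w j) ^ 2 ∂(gaussianReal 0 1) :=
        (integral_finsetSum _ fun j _ => hi j).symm
    _ ≤ ∫ z, (s ^ 2 / dx M ^ 2 * gradSq w) * z ^ 2 ∂(gaussianReal 0 1) := by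
        refine integral_mono (integrable_finsetSum _ fun j _ => hi j)
          (integrable_sq_gaussianReal.const_mul _) fun z => ?_
        refine (sum_interp_sub_sq_le w (s * z)).trans_eq ?_
        rw [div_pow, mul_pow]
        ring
    _ = s ^ 2 / dx M ^ 2 * gradSq w := by
        rw [integral_const_mul, integral_sq_gaussianReal, mul_one]

end AveragedStep

/-! ### Smoothing by the Gaussian noise -/

section Smoothing

/-- The Cameron-Martin formula for a translation of the noise by `a`. -/
theorem integral_gaussianReal_add (f : ℝ → ℝ) (a : ℝ) :
    ∫ z, f (z + a) ∂(gaussianReal 0 1) =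
      ∫ z, f z * Real.exp (a * z - a ^ 2 / 2) ∂(gaussianReal 0 1) := by
  rw [integral_gaussianReal_eq_integral_smul one_ne_zero,
    integral_gaussianReal_eq_integral_smul one_ne_zero,
    ← integral_sub_right_eq_self _ a]
  refine integral_congr_ae (Filter.Eventually.of_forall fun z => ?_)
  simp only [sub_add_cancel, smul_eq_mul, gaussianPDFReal]
  rw [show -(z - a - 0) ^ 2 / (2 * ((1 : NNReal) : ℝ)) =
    -(z - 0) ^ 2 / (2 * ((1 : NNReal) : ℝ)) + (a * z - a ^ 2 / 2) by
      simp only [NNReal.coe_one]; ring, Real.exp_add]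
  ring

theorem integral_exp_gaussianReal (a : ℝ) :
    ∫ z, Real.exp (a * z) ∂(gaussianReal 0 1) = Real.exp (a ^ 2 / 2) := by
  have := congrFun (mgf_id_gaussianReal (μ := 0) (v := 1)) a
  simpa [mgf] using this

theorem covariance_sq_le {Ω : Type*} [MeasurableSpace Ω] {P : Measure Ω} [IsProbabilityMeasure P]
    {X Y : Ω → ℝ} (hX : MemLp X 2 P) (hY : MemLp Y 2 P) :
    cov[X, Y; P] ^ 2 ≤ Var[X; P] * Var[Y; P] := by
  have h : ∀ t : ℝ, 0 ≤ Var[Y; P] * (t * t) + 2 * cov[X, Y; P] * t + Var[X; P] := fun t => by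
    have h1 := variance_fun_add hX (hY.const_mul t)
    rw [variance_const_mul, covariance_const_mul_right] at h1
    have h2 := variance_nonneg (fun ω => X ω + t * Y ω) P
    linarith
  have := discrim_le_zero h
  rw [discrim] at this
  linarith

theorem memLp_exp_gaussianReal (a : ℝ) :
    MemLp (fun z => Real.exp (a * z - a ^ 2 / 2)) 2 (gaussianReal 0 1) := by
  rw [memLp_two_iff_integrable_sq (by fun_prop)]
  have : (fun z : ℝ => Real.exp (a * z - a ^ 2 / 2) ^ 2) =
      fun z => Real.exp (-a ^ 2) * Real.exp (2 * a * z) := by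
    funext z
    rw [← Real.exp_nat_mul, ← Real.exp_add]
    congr 1
    push_cast
    ring
  rw [this]
  exact (integrable_exp_mul_gaussianReal (2 * a)).const_mul _

theorem integral_exp_weight (a : ℝ) :
    ∫ z, Real.exp (a * z - a ^ 2 / 2) ∂(gaussianReal 0 1) = 1 := by
  simp_rw [sub_eq_add_neg, Real.exp_add]
  rw [integral_mul_const, integral_exp_gaussianReal, ← Real.exp_add, add_neg_cancel, Real.exp_zero]

theorem variance_exp_weight (a : ℝ) :
    Var[fun z => Real.exp (a * z - a ^ 2 / 2); gaussianReal 0 1] = Real.exp (a ^ 2) - 1 := by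
  rw [variance_eq_sub (memLp_exp_gaussianReal a), integral_exp_weight, one_pow]
  congr 1
  have : ∀ z : ℝ, ((fun z : ℝ => Real.exp (a * z - a ^ 2 / 2)) ^ 2) z =
      Real.exp (2 * a * z) * Real.exp (-a ^ 2) := fun z => by
    simp only [Pi.pow_apply]
    rw [← Real.exp_nat_mul, ← Real.exp_add]
    congr 1
    push_cast
    ring
  simp_rw [this]
  rw [integral_mul_const, integral_exp_gaussianReal, ← Real.exp_add]
  congr 1
  ring

/-- A translation of the noise by `a` changes the mean by at most `√(exp (a²) - 1)` standard
deviations. -/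
theorem sq_integral_translate_sub_le {f : ℝ → ℝ} (hf : MemLp f 2 (gaussianReal 0 1)) (a : ℝ) :
    (∫ z, f (z + a) ∂(gaussianReal 0 1) - ∫ z, f z ∂(gaussianReal 0 1)) ^ 2 ≤
      (Real.exp (a ^ 2) - 1) * Var[f; gaussianReal 0 1] := by
  have h := covariance_sq_le hf (memLp_exp_gaussianReal a)
  rw [covariance_eq_sub hf (memLp_exp_gaussianReal a), integral_exp_weight, mul_one,
    variance_exp_weight] at h
  rw [integral_gaussianReal_add]
  exact h.trans_eq (mul_comm _ _)

variable {M : ℕ} [NeZero M]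

/-- The averaged step smooths: the gradient of its output is controlled by its dissipation. -/
theorem gradSq_avgStep_le_dissipation {s : ℝ} (hs : 0 < s) (w : Fin M → ℝ) :
    gradSq (avgStep s w) ≤
      (Real.exp ((dx M / s) ^ 2) - 1) * (w ⬝ᵥ w - avgStep s w ⬝ᵥ avgStep s w) := by
  have hx : 0 ≤ Real.exp ((dx M / s) ^ 2) - 1 := by
    have := Real.one_le_exp (sq_nonneg (dx M / s))
    linarith
  refine le_trans ?_ (mul_le_mul_of_nonneg_left (sum_sampleVar_le s w) hx)
  rw [gradSq_eq_sum, Finset.mul_sum]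
  refine Finset.sum_le_sum fun j _ => ?_
  refine le_of_eq_of_le ?_ (sq_integral_translate_sub_le (memLp_interp w (node j) s) (dx M / s))
  rw [avgStep_apply, avgStep_apply]
  congr 2
  refine integral_congr_ae (Filter.Eventually.of_forall fun z => ?_)
  simp only
  rw [interp_node_add_one]
  congr 1
  field_simp
  ring

theorem sum_range_residue (f : Fin M → ℝ) : ∑ a ∈ Finset.range M, f (residue M a) = ∑ j, f j := by
  rw [Finset.sum_range]
  simp only [residue_val]

/-- A discrete one-dimensional Sobolev inequality on the cycle. -/
theorem sub_sq_le_gradSq (w : Fin M → ℝ) (j k : Fin M) :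
    (w j - w k) ^ 2 ≤ M * gradSq w := by
  set i : ℕ := ((j - k : Fin M) : ℕ) with hi
  have hj : j = k + residue M i := by rw [hi, residue_val, add_sub_cancel]
  have hr : w j - w k =
      ∑ a ∈ Finset.range i, (w (k + residue M a + 1) - w (k + residue M a)) := by
    have h := Finset.sum_range_sub (fun a : ℕ => w (k + residue M a)) i
    simp only [Nat.cast_add, Nat.cast_one, residue_add_one, ← add_assoc] at h
    rw [h, ← hj]
    simp [residue]
  have hiM : i ≤ M := (j - k).2.le
  calc (w j - w k) ^ 2
      ≤ i * ∑ a ∈ Finset.range i, (w (k + residue M a + 1) - w (k + residue M a)) ^ 2 := by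
        rw [hr]
        simpa using sq_sum_le_card_mul_sum_sq (s := Finset.range i)
          (f := fun a : ℕ => w (k + residue M a + 1) - w (k + residue M a))
    _ ≤ M * ∑ a ∈ Finset.range M, (w (k + residue M a + 1) - w (k + residue M a)) ^ 2 := by
        gcongr
    _ = M * gradSq w := by
        rw [gradSq_eq_sum, sum_range_residue fun a => (w (k + a + 1) - w (k + a)) ^ 2]
        congr 1
        exact Equiv.sum_comp (Equiv.addLeft k) fun j => (w (j + 1) - w j) ^ 2

/-- The unit mass at the node `j`. -/
def unit {M : ℕ} (j : Fin M) : Fin M → ℝ := Pi.single j 1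

theorem dotProduct_unit {M : ℕ} (w : Fin M → ℝ) (j : Fin M) : w ⬝ᵥ unit j = w j := by
  simp [unit]

theorem dotProduct_shift (w : Fin M → ℝ) : shift w ⬝ᵥ shift w = w ⬝ᵥ w :=
  sum_comp_add_one fun j => w j * w j

theorem avgStep_pow_shift (s : ℝ) (m : ℕ) (w : Fin M → ℝ) :
    (avgStep s ^ m) (shift w) = shift ((avgStep s ^ m) w) := by
  induction m generalizing w with
  | zero => rfl
  | succ m ih => rw [pow_succ, Module.End.mul_apply, Module.End.mul_apply, avgStep_shift, ih]

/-- The squared `ℓ²` norm left after `m` averaged steps from a unit mass. -/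
noncomputable def kernelSq (M : ℕ) [NeZero M] (s : ℝ) (m : ℕ) : ℝ :=
  (avgStep s ^ m) (unit (0 : Fin M)) ⬝ᵥ (avgStep s ^ m) (unit (0 : Fin M))

theorem dotProduct_avgStep_pow_unit (s : ℝ) (m : ℕ) (j : Fin M) :
    (avgStep s ^ m) (unit j) ⬝ᵥ (avgStep s ^ m) (unit j) = kernelSq M s m := by
  have hstep : ∀ j : Fin M, (avgStep s ^ m) (unit (j + 1)) ⬝ᵥ (avgStep s ^ m) (unit (j + 1)) =
      (avgStep s ^ m) (unit j) ⬝ᵥ (avgStep s ^ m) (unit j) := fun j => by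
    have : unit j = shift (unit (j + 1)) := by
      funext i
      simp [unit, shift_apply, Pi.single_apply]
    rw [this, avgStep_pow_shift, dotProduct_shift]
  have hnat : ∀ n : ℕ, (avgStep s ^ m) (unit (residue M n)) ⬝ᵥ
      (avgStep s ^ m) (unit (residue M n)) = kernelSq M s m := fun n => by
    induction n with
    | zero => simp [residue, kernelSq]
    | succ n ih => rw [Nat.cast_succ, residue_add_one, hstep, ih]
  simpa only [residue_val] using hnat j

theorem kernelSq_nonneg (s : ℝ) (m : ℕ) : 0 ≤ kernelSq M s m := dotProduct_self_nonneg' _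

theorem avgStep_pow_contraction (s : ℝ) (m : ℕ) (w : Fin M → ℝ) :
    (avgStep s ^ m) w ⬝ᵥ (avgStep s ^ m) w ≤ w ⬝ᵥ w := by
  induction m with
  | zero => rfl
  | succ m ih =>
    rw [pow_succ', Module.End.mul_apply]
    exact (avgStep_contraction s _).trans ih

theorem kernelSq_le_one (s : ℝ) (m : ℕ) : kernelSq M s m ≤ 1 :=
  (avgStep_pow_contraction s m _).trans_eq (by simp [unit])

theorem avgStep_pow_nonneg (s : ℝ) (m : ℕ) {w : Fin M → ℝ} (hw : ∀ k, 0 ≤ w k) (j : Fin M) :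
    0 ≤ (avgStep s ^ m) w j := by
  induction m generalizing j with
  | zero => exact hw j
  | succ m ih =>
    rw [pow_succ', Module.End.mul_apply]
    exact avgStep_nonneg s ih j

theorem sum_avgStep_pow (s : ℝ) (m : ℕ) (w : Fin M → ℝ) :
    ∑ j, (avgStep s ^ m) w j = ∑ j, w j := by
  induction m with
  | zero => rfl
  | succ m ih => rw [pow_succ', Module.End.mul_apply, sum_avgStep, ih]

theorem dotProduct_avgStep_pow {M : ℕ} (s : ℝ) (m : ℕ) (v w : Fin M → ℝ) :
    v ⬝ᵥ (avgStep s ^ m) w = (avgStep s ^ m) v ⬝ᵥ w := by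
  induction m generalizing v with
  | zero => rfl
  | succ m ih =>
    rw [pow_succ', Module.End.mul_apply, dotProduct_avgStep, ih, ← Module.End.mul_apply, ← pow_succ,
      pow_succ']

theorem avgStep_le {s c : ℝ} {w : Fin M → ℝ} (hw : ∀ k, w k ≤ c) (j : Fin M) :
    avgStep s w j ≤ c := by
  have h := avgStep_nonneg s (w := (fun _ => c) - w) (fun k => sub_nonneg.2 (hw k)) j
  rw [map_sub, avgStep_const] at h
  exact sub_nonneg.1 h

/-- The Green function bound: with `g = ∑_{m<n} P^{2m} e₀`, the quantity `A = ∑_{m<n} |P^m e₀|²`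
is the value `g₀`, and it bounds the dissipation `|g|² - |Pg|²`. The smoothing estimate and the
Sobolev inequality then bound the oscillation of `Pg`, hence `g₀` itself, by `√A`. -/
theorem sum_kernelSq_le {s : ℝ} (hs : 0 < s) (n : ℕ) :
    ∑ m ∈ Finset.range n, kernelSq M s m ≤ 1 + n * dx M +
      √(M * (Real.exp ((dx M / s) ^ 2) - 1) * ∑ m ∈ Finset.range n, kernelSq M s m) := by
  set P : (Fin M → ℝ) →ₗ[ℝ] (Fin M → ℝ) := avgStep s with hP
  set e : Fin M → ℝ := unit 0 with he
  have he0 : ∀ k, 0 ≤ e k := fun k => by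
    rw [he, unit, Pi.single_apply]
    split_ifs <;> norm_num
  set g : Fin M → ℝ := ∑ m ∈ Finset.range n, (P ^ (2 * m)) e with hg
  have hgn : ∀ k, 0 ≤ g k := fun k => by
    rw [hg, Finset.sum_apply]
    exact Finset.sum_nonneg fun m _ => avgStep_pow_nonneg s _ he0 k
  have hA : ∑ m ∈ Finset.range n, kernelSq M s m = g 0 := by
    rw [hg, Finset.sum_apply]
    refine Finset.sum_congr rfl fun m _ => ?_
    rw [kernelSq, ← dotProduct_unit ((P ^ (2 * m)) e) 0, two_mul, pow_add, Module.End.mul_apply,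
      hP, dotProduct_avgStep_pow]
  have hPg : P (P g) = g - e + (P ^ (2 * n)) e := by
    have h := Finset.sum_range_sub (fun m => (P ^ (2 * m)) e) n
    rw [Finset.sum_sub_distrib, mul_zero, pow_zero, Module.End.one_apply] at h
    have h2 : P (P g) = ∑ m ∈ Finset.range n, (P ^ (2 * (m + 1))) e := by
      rw [hg, map_sum, map_sum]
      refine Finset.sum_congr rfl fun m _ => ?_
      rw [mul_add, mul_one, pow_add, (Commute.pow_pow_self P _ _).eq, Module.End.mul_apply, pow_two,
        Module.End.mul_apply]
    rw [h2, sub_eq_iff_eq_add.1 h, hg]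
    abel
  have hdiss : g ⬝ᵥ g - P g ⬝ᵥ P g ≤ g 0 := by
    have h1 : P g ⬝ᵥ P g = g ⬝ᵥ P (P g) := (dotProduct_avgStep s g (P g)).symm
    have h2 : 0 ≤ g ⬝ᵥ (P ^ (2 * n)) e :=
      Finset.sum_nonneg fun k _ => mul_nonneg (hgn k) (avgStep_pow_nonneg s _ he0 k)
    rw [h1, hPg, dotProduct_add, dotProduct_sub, he, dotProduct_unit, ← he]
    linarith
  set x : ℝ := Real.exp ((dx M / s) ^ 2) - 1 with hx
  have hx0 : 0 ≤ x := by
    have := Real.one_le_exp (sq_nonneg (dx M / s))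
    linarith
  have hgrad : gradSq (P g) ≤ x * g 0 :=
    (gradSq_avgStep_le_dissipation hs g).trans (mul_le_mul_of_nonneg_left hdiss hx0)
  -- Some value of `Pg` is at most its average, which is `n / M` because mass is preserved.
  have hmean : ∑ j, P g j = n := by
    rw [hP, sum_avgStep, hg]
    simp only [Finset.sum_apply]
    rw [Finset.sum_comm]
    simp [hP, sum_avgStep_pow, he, unit]
  obtain ⟨k, -, hk⟩ : ∃ k ∈ Finset.univ, P g k ≤ n * dx M := by
    refine Finset.exists_le_of_sum_le Finset.univ_nonempty ?_
    rw [hmean]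
    simp only [Finset.sum_const, Finset.card_univ, Fintype.card_fin, nsmul_eq_mul]
    exact le_of_eq (by linear_combination (-(n : ℝ)) * dx_mul (M := M))
  have hmax : ∀ j, P g j ≤ n * dx M + √(M * x * g 0) := fun j => by
    have h1 := sub_sq_le_gradSq (P g) j k
    have h2 : (P g j - P g k) ^ 2 ≤ M * x * g 0 := by
      rw [mul_assoc]
      exact h1.trans (mul_le_mul_of_nonneg_left hgrad (Nat.cast_nonneg M))
    have := Real.le_sqrt_of_sq_le h2
    linarith
  have h0 := congrFun hPg 0
  have h1 : P (P g) 0 ≤ n * dx M + √(M * x * g 0) := avgStep_le hmax 0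
  have h2 : 0 ≤ (P ^ (2 * n)) e 0 := avgStep_pow_nonneg s _ he0 0
  have h3 : e 0 = 1 := by simp [he, unit]
  simp only [Pi.add_apply, Pi.sub_apply, h3] at h0
  rw [hA]
  linarith

theorem sum_kernelSq_le_of_le {s : ℝ} (hs : 0 < s) (h : dx M ^ 2 ≤ s ^ 2) (n : ℕ) :
    ∑ m ∈ Finset.range n, kernelSq M s m ≤ 2 + 2 * (n * dx M) + 2 * (dx M / s ^ 2) := by
  set A := ∑ m ∈ Finset.range n, kernelSq M s m with hA
  have hA0 : 0 ≤ A := Finset.sum_nonneg fun m _ => kernelSq_nonneg s m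
  have hd := dx_pos (M := M)
  have hx1 : (dx M / s) ^ 2 ≤ 1 := by
    rw [div_pow]
    exact div_le_one_of_le₀ h (by positivity)
  have hexp : Real.exp ((dx M / s) ^ 2) - 1 ≤ 2 * (dx M / s) ^ 2 := by
    have := Real.abs_exp_sub_one_le (x := (dx M / s) ^ 2) (by rwa [abs_of_nonneg (sq_nonneg _)])
    rw [abs_of_nonneg (sq_nonneg (dx M / s))] at this
    exact (le_abs_self _).trans this
  have hy : M * (Real.exp ((dx M / s) ^ 2) - 1) * A ≤ 2 * (dx M / s ^ 2) * A := by
    refine mul_le_mul_of_nonneg_right ?_ hA0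
    refine (mul_le_mul_of_nonneg_left hexp (Nat.cast_nonneg M)).trans_eq ?_
    rw [div_pow, sq (dx M)]
    linear_combination (2 * dx M / s ^ 2) * dx_mul (M := M)
  have hsq : √(M * (Real.exp ((dx M / s) ^ 2) - 1) * A) ≤ A / 2 + dx M / s ^ 2 := by
    refine Real.sqrt_le_iff.2 ⟨by positivity, hy.trans ?_⟩
    nlinarith [sq_nonneg (A / 2 - dx M / s ^ 2)]
  have := sum_kernelSq_le (M := M) hs n
  linarith

/-- In the regime `δx² ≤ δt` this is the Green function bound; otherwise each of the at most
`T / δt` terms is at most `1`, and `1 / δt ≤ δx² / δt²`. -/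
theorem sum_kernelSq_le_of_time {T δt : ℝ} (hT : 0 < T) (hδ : 0 < δt) {n : ℕ} (hn : n * δt ≤ T) :
    ∑ m ∈ Finset.range n, kernelSq M √δt m ≤
      2 * (T + 1) * (1 + dx M / δt + dx M ^ 2 / δt ^ 2) := by
  have hd := dx_pos (M := M)
  rcases le_or_gt (dx M ^ 2) δt with h | h
  · have h1 := sum_kernelSq_le_of_le (M := M) (s := √δt) (Real.sqrt_pos.2 hδ)
      (by rwa [Real.sq_sqrt hδ.le]) n
    rw [Real.sq_sqrt hδ.le] at h1
    have h2 : n * dx M ≤ T * (dx M / δt) := by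
      rw [mul_div_assoc', le_div_iff₀ hδ]
      nlinarith
    have h3 : 0 ≤ T * (dx M ^ 2 / δt ^ 2) := by positivity
    have h4 : 0 ≤ dx M ^ 2 / δt ^ 2 := by positivity
    linarith
  · have h1 : ∑ m ∈ Finset.range n, kernelSq M √δt m ≤ n := by
      simpa using Finset.sum_le_card_nsmul (Finset.range n) _ 1
        fun m _ => kernelSq_le_one (M := M) √δt m
    have h2 : (n : ℝ) ≤ T * (dx M ^ 2 / δt ^ 2) := by
      rw [mul_div_assoc', le_div_iff₀ (by positivity)]
      calc (n : ℝ) * δt ^ 2 = n * δt * δt := by ring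
        _ ≤ T * dx M ^ 2 := by gcongr
    have h3 : 0 ≤ T * (dx M ^ 2 / δt ^ 2) := by positivity
    have h4 : 0 ≤ dx M ^ 2 / δt ^ 2 := by positivity
    have h5 : 0 ≤ dx M / δt := by positivity
    nlinarith

end Smoothing

/-! ### One Monte-Carlo step -/

section MonteCarloStep

variable {M N : ℕ} [NeZero M]

/-- One step of the Monte-Carlo scheme from `w`, with noise values `z` of standard deviation
`s`. -/
noncomputable def mcStep {M N : ℕ} (s : ℝ) (w : Fin M → ℝ) (z : Fin N × Fin M → ℝ) : Fin M → ℝ :=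
  fun j => 1 / (N : ℝ) * ∑ m : Fin N, interp w (node j + s * z (m, j))

theorem measurable_mcStep (s : ℝ) :
    Measurable fun q : (Fin M → ℝ) × (Fin N × Fin M → ℝ) => mcStep s q.1 q.2 := by
  refine measurable_pi_lambda _ fun j => ?_
  refine (Finset.measurable_sum _ fun m _ => Finset.measurable_sum _ fun k _ => ?_).const_mul _
  refine Measurable.mul (by fun_prop) ((measurable_phi k).comp (by fun_prop))

theorem measurable_linearMap {M : ℕ} (Q : (Fin M → ℝ) →ₗ[ℝ] (Fin M → ℝ)) : Measurable Q :=
  (LinearMap.continuous_of_finiteDimensional Q).measurable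

theorem measurable_dotProduct_self {M : ℕ} : Measurable fun w : Fin M → ℝ => w ⬝ᵥ w :=
  Finset.measurable_sum _ fun k _ => (measurable_pi_apply k).mul (measurable_pi_apply k)

theorem linearMap_apply_eq_sum {M : ℕ} (Q : (Fin M → ℝ) →ₗ[ℝ] (Fin M → ℝ)) (w : Fin M → ℝ)
    (i : Fin M) : Q w i = ∑ j, w j * Q (unit j) i := by
  conv_lhs => rw [pi_eq_sum_univ' w]
  simp only [map_sum, map_smul, Finset.sum_apply, Pi.smul_apply, smul_eq_mul]
  rfl

/-- Bias-variance decomposition of one Monte-Carlo step from a fixed state. The samples are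
independent, so only the diagonal terms of the variance survive. -/
theorem integral_mcStep_sq (hN : 1 ≤ N) (s : ℝ) (Q : (Fin M → ℝ) →ₗ[ℝ] (Fin M → ℝ))
    (w b : Fin M → ℝ) :
    ∫ z, Q (mcStep s w z - b) ⬝ᵥ Q (mcStep s w z - b)
        ∂(Measure.pi fun _ : Fin N × Fin M => gaussianReal 0 1) =
      Q (avgStep s w - b) ⬝ᵥ Q (avgStep s w - b) +
        1 / (N : ℝ) * ∑ j, (Q (unit j) ⬝ᵥ Q (unit j)) * sampleVar s w j := by
  have hN' : (N : ℝ) ≠ 0 := by exact_mod_cast (by omega : N ≠ 0)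
  set π := Measure.pi fun _ : Fin N × Fin M => gaussianReal 0 1 with hπ
  let X : Fin M → Fin N × Fin M → ℝ → ℝ := fun i a x =>
    (1 / (N : ℝ) * Q (unit a.2) i) * interp w (node a.2 + s * x)
  have hX : ∀ i a, MemLp (X i a) 2 (gaussianReal 0 1) := fun i a =>
    (memLp_interp w (node a.2) s).const_mul _
  have hXe : ∀ i a, MemLp (fun z : Fin N × Fin M → ℝ => X i a (z a)) 2 π := fun i a =>
    (hX i a).comp_measurePreserving
      (measurePreserving_eval (fun _ : Fin N × Fin M => gaussianReal 0 1) a)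
  have hYeq : ∀ i z, Q (mcStep s w z - b) i = ∑ a, X i a (z a) - Q b i := fun i z => by
    rw [map_sub, Pi.sub_apply, linearMap_apply_eq_sum Q (mcStep s w z)]
    congr 1
    rw [Fintype.sum_prod_type_right]
    refine Finset.sum_congr rfl fun j _ => ?_
    simp only [mcStep, X, Finset.mul_sum, Finset.sum_mul]
    exact Finset.sum_congr rfl fun m _ => by ring
  have hS : ∀ i, MemLp (fun z : Fin N × Fin M → ℝ => ∑ a, X i a (z a)) 2 π := fun i =>
    memLp_finsetSum _ fun a _ => hXe i a
  have hY : ∀ i, MemLp (fun z => Q (mcStep s w z - b) i) 2 π := fun i => by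
    simp only [hYeq]
    exact (hS i).sub (memLp_const _)
  have hmean : ∀ i, ∫ z, Q (mcStep s w z - b) i ∂π = Q (avgStep s w - b) i := fun i => by
    simp only [hYeq]
    rw [integral_sub ((hS i).integrable one_le_two) (integrable_const _),
      integral_finsetSum _ fun a _ => (hXe i a).integrable one_le_two, integral_const,
      map_sub, Pi.sub_apply, linearMap_apply_eq_sum Q (avgStep s w), Fintype.sum_prod_type_right]
    simp only [probReal_univ, one_smul]
    congr 1
    refine Finset.sum_congr rfl fun j _ => ?_
    have h : ∀ m : Fin N, ∫ z, X i (m, j) (z (m, j)) ∂π =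
        1 / (N : ℝ) * Q (unit j) i * avgStep s w j := fun m => by
      have h1 := (measurePreserving_eval
        (fun _ : Fin N × Fin M => gaussianReal 0 1) (m, j)).map_eq
      have h2 := integral_map (μ := π) (φ := fun z : Fin N × Fin M → ℝ => z (m, j))
        (measurable_pi_apply _).aemeasurable (f := X i (m, j))
        (by
          have := (hX i (m, j)).1
          rwa [← h1] at this)
      rw [← h2, hπ]
      refine (congrArg (fun μ => ∫ y, X i (m, j) y ∂μ) h1).trans ?_
      simp only [X]
      rw [integral_const_mul, avgStep_apply]
    simp only [h, Finset.sum_const, Finset.card_univ, Fintype.card_fin, nsmul_eq_mul]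
    field_simp
  have hvar : ∀ i, Var[fun z => Q (mcStep s w z - b) i; π] =
      1 / (N : ℝ) * ∑ j, Q (unit j) i ^ 2 * sampleVar s w j := fun i => by
    simp only [hYeq]
    rw [variance_sub_const (hS i).1]
    have h := variance_sum_pi (μ := fun _ : Fin N × Fin M => gaussianReal 0 1) (hX i)
    have hfun : (∑ a, fun z : Fin N × Fin M → ℝ => X i a (z a)) = fun z => ∑ a, X i a (z a) := by
      funext z
      simp
    rw [hfun] at h
    rw [h, Fintype.sum_prod_type_right, Finset.mul_sum]
    refine Finset.sum_congr rfl fun j _ => ?_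
    simp only [X, variance_const_mul, ← sampleVar.eq_1, Finset.sum_const, Finset.card_univ,
      Fintype.card_fin, nsmul_eq_mul]
    field_simp
  have hsq : ∀ i, ∫ z, Q (mcStep s w z - b) i * Q (mcStep s w z - b) i ∂π =
      Q (avgStep s w - b) i * Q (avgStep s w - b) i +
        1 / (N : ℝ) * ∑ j, Q (unit j) i ^ 2 * sampleVar s w j := fun i => by
    have h := variance_eq_sub (hY i)
    rw [hvar i, hmean i] at h
    simp only [Pi.pow_apply, sq (Q (mcStep s w _ - b) i)] at h
    rw [h]
    ring
  simp only [dotProduct]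
  rw [integral_finsetSum _ fun i _ => show Integrable (fun z => Q (mcStep s w z - b) i *
    Q (mcStep s w z - b) i) π from (hY i).integrable_mul (hY i)]
  simp only [hsq, Finset.sum_add_distrib, ← Finset.mul_sum]
  rw [Finset.sum_comm]
  simp only [Finset.sum_mul, sq]

theorem abs_mcStep_le (hN : 1 ≤ N) (s : ℝ) {w : Fin M → ℝ} {R : ℝ} (hR : ∀ k, |w k| ≤ R)
    (z : Fin N × Fin M → ℝ) (k : Fin M) : |mcStep s w z k| ≤ R := by
  have hNpos : (0 : ℝ) < N := by exact_mod_cast hN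
  rw [mcStep, abs_mul, abs_of_pos (by positivity), one_div, inv_mul_le_iff₀ hNpos]
  refine (Finset.abs_sum_le_sum_abs _ _).trans ?_
  simpa using Finset.sum_le_card_nsmul Finset.univ
    (fun m : Fin N => |interp w (node k + s * z (m, k))|) R fun m _ => abs_interp_le hR _

theorem abs_avgStep_le (s : ℝ) {w : Fin M → ℝ} {R : ℝ} (hR : ∀ k, |w k| ≤ R) (k : Fin M) :
    |avgStep s w k| ≤ R := by
  have := avgStep_le (s := s) (w := -w) (c := R) (fun k => neg_le.1 (abs_le.1 (hR k)).1) k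
  rw [map_neg, Pi.neg_apply] at this
  exact abs_le.2 ⟨by linarith, avgStep_le (fun k => (abs_le.1 (hR k)).2) k⟩

theorem measurable_sampleVar (s : ℝ) (j : Fin M) :
    Measurable fun w : Fin M → ℝ => sampleVar s w j := by
  simp only [sampleVar_eq]
  have h : Measurable fun q : (Fin M → ℝ) × ℝ => interp q.1 (node j + s * q.2) ^ 2 := by
    refine (Finset.measurable_sum _ fun k _ => ?_).pow_const 2
    exact Measurable.mul (by fun_prop) ((measurable_phi k).comp (by fun_prop))
  refine (h.stronglyMeasurable.integral_prod_right (ν := gaussianReal 0 1)).measurable.sub ?_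
  exact ((measurable_pi_apply j).comp (measurable_linearMap _)).pow_const 2

theorem exists_linearMap_bound {M : ℕ} (Q : (Fin M → ℝ) →ₗ[ℝ] (Fin M → ℝ)) (R : ℝ) :
    ∃ B, ∀ w : Fin M → ℝ, (∀ k, |w k| ≤ R) → Q w ⬝ᵥ Q w ≤ B := by
  have hc : Continuous fun w : Fin M → ℝ => Q w ⬝ᵥ Q w := by
    have := LinearMap.continuous_of_finiteDimensional Q
    unfold dotProduct
    fun_prop
  obtain ⟨B, hB⟩ := (isCompact_univ_pi fun _ : Fin M =>
    isCompact_Icc (a := -R) (b := R)).bddAbove_image hc.continuousOn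
  exact ⟨B, fun w hw => hB ⟨w, fun k _ => abs_le.1 (hw k), rfl⟩⟩

theorem integrable_of_bounded {Ω : Type*} [MeasurableSpace Ω] {P : Measure Ω} [IsFiniteMeasure P]
    {f : Ω → ℝ} (hf : Measurable f) (h0 : ∀ ω, 0 ≤ f ω) {B : ℝ} (h : ∀ ω, f ω ≤ B) :
    Integrable f P :=
  (memLp_two_of_bounded hf (R := B) fun ω => by
    rw [abs_of_nonneg (h0 ω)]
    exact h ω).integrable one_le_two

variable {Ω : Type*} [MeasurableSpace Ω] {P : Measure Ω} [IsProbabilityMeasure P]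

theorem integrable_dotProduct_linearMap {M : ℕ} {X : Ω → Fin M → ℝ} (hX : Measurable X) {R : ℝ}
    (hR : ∀ ω k, |X ω k| ≤ R) (Q : (Fin M → ℝ) →ₗ[ℝ] (Fin M → ℝ)) :
    Integrable (fun ω => Q (X ω) ⬝ᵥ Q (X ω)) P := by
  obtain ⟨B, hB⟩ := exists_linearMap_bound Q R
  exact integrable_of_bounded
    (measurable_dotProduct_self.comp ((measurable_linearMap Q).comp hX))
    (fun ω => dotProduct_self_nonneg' _) fun ω => hB _ (hR ω)

theorem integrable_sampleVar {X : Ω → Fin M → ℝ} (hX : Measurable X) {R : ℝ}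
    (hR : ∀ ω k, |X ω k| ≤ R) (s : ℝ) (j : Fin M) :
    Integrable (fun ω => sampleVar s (X ω) j) P := by
  obtain ⟨B, hB⟩ := exists_linearMap_bound (LinearMap.id (R := ℝ) (M := Fin M → ℝ)) R
  refine integrable_of_bounded ((measurable_sampleVar s j).comp hX)
    (fun ω => sampleVar_nonneg _ _ _) (B := B) fun ω => ?_
  calc sampleVar s (X ω) j ≤ ∑ j, sampleVar s (X ω) j :=
        Finset.single_le_sum (fun j _ => sampleVar_nonneg s (X ω) j) (Finset.mem_univ j)
    _ ≤ X ω ⬝ᵥ X ω := sum_sampleVar_le_self s _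
    _ ≤ B := hB _ (hR ω)

/-- Bias-variance decomposition of one Monte-Carlo step from a random state that is independent
of the noise of the step. -/
theorem integral_mcStep_sq_of_indep (hN : 1 ≤ N) (s : ℝ) (Q : (Fin M → ℝ) →ₗ[ℝ] (Fin M → ℝ))
    (b : Fin M → ℝ) {X : Ω → Fin M → ℝ} (hX : Measurable X) {R : ℝ} (hR : ∀ ω k, |X ω k| ≤ R)
    {Z : Ω → Fin N × Fin M → ℝ} (hZ : Measurable Z)
    (hlaw : P.map Z = Measure.pi fun _ => gaussianReal 0 1) (hind : IndepFun X Z P) :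
    ∫ ω, Q (mcStep s (X ω) (Z ω) - b) ⬝ᵥ Q (mcStep s (X ω) (Z ω) - b) ∂P =
      ∫ ω, Q (avgStep s (X ω) - b) ⬝ᵥ Q (avgStep s (X ω) - b) ∂P +
        1 / (N : ℝ) * ∑ j, (Q (unit j) ⬝ᵥ Q (unit j)) * ∫ ω, sampleVar s (X ω) j ∂P := by
  have hmapX : IsProbabilityMeasure (P.map X) := Measure.isProbabilityMeasure_map hX.aemeasurable
  obtain ⟨F, hFdef⟩ : ∃ F : (Fin M → ℝ) × (Fin N × Fin M → ℝ) → ℝ, F = fun q =>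
    Q (mcStep s q.1 q.2 - b) ⬝ᵥ Q (mcStep s q.1 q.2 - b) := ⟨_, rfl⟩
  have hF : Measurable F := by
    rw [hFdef]
    exact measurable_dotProduct_self.comp
      ((measurable_linearMap Q).comp ((measurable_mcStep s).sub measurable_const))
  have hjoint : P.map (fun ω => (X ω, Z ω)) =
      (P.map X).prod (Measure.pi fun _ : Fin N × Fin M => gaussianReal 0 1) := by
    have := (indepFun_iff_map_prod_eq_prod_map_map hX.aemeasurable hZ.aemeasurable).1 hind
    rw [this, hlaw]
  obtain ⟨Rb, hRb⟩ := exists_abs_le b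
  have hbd : ∀ w : Fin M → ℝ, (∀ k, |w k| ≤ R) → ∀ k, |(w - b) k| ≤ R + Rb := fun w hw k =>
    (abs_sub _ _).trans (add_le_add (hw k) (hRb k))
  have hstep : ∀ ω k, |mcStep s (X ω) (Z ω) k| ≤ R := fun ω => abs_mcStep_le hN s (hR ω) _
  have hmeas : Measurable fun ω => mcStep s (X ω) (Z ω) :=
    Measurable.comp (g := fun q : (Fin M → ℝ) × (Fin N × Fin M → ℝ) => mcStep s q.1 q.2)
      (f := fun ω => (X ω, Z ω)) (measurable_mcStep s) (hX.prodMk hZ)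
  have hint : Integrable F ((P.map X).prod (Measure.pi fun _ => gaussianReal 0 1)) := by
    rw [← hjoint, integrable_map_measure hF.aestronglyMeasurable (hX.prodMk hZ).aemeasurable, hFdef]
    exact integrable_dotProduct_linearMap (hmeas.sub measurable_const)
      (fun ω => hbd _ (hstep ω)) Q
  have havg : ∀ ω k, |avgStep s (X ω) k| ≤ R := fun ω => abs_avgStep_le s (hR ω)
  have hint1 : Integrable (fun ω => Q (avgStep s (X ω) - b) ⬝ᵥ Q (avgStep s (X ω) - b)) P :=
    integrable_dotProduct_linearMap
      (((measurable_linearMap _).comp hX).sub measurable_const) (fun ω => hbd _ (havg ω)) Q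
  have hint2 : ∀ j, Integrable (fun ω => (Q (unit j) ⬝ᵥ Q (unit j)) * sampleVar s (X ω) j) P :=
    fun j => (integrable_sampleVar hX hR s j).const_mul _
  calc ∫ ω, Q (mcStep s (X ω) (Z ω) - b) ⬝ᵥ Q (mcStep s (X ω) (Z ω) - b) ∂P
      = ∫ ω, F (X ω, Z ω) ∂P := by rw [hFdef]
    _ = ∫ q, F q ∂(P.map fun ω => (X ω, Z ω)) :=
        (integral_map (hX.prodMk hZ).aemeasurable hF.aestronglyMeasurable).symm
    _ = ∫ w, ∫ z, F (w, z) ∂(Measure.pi fun _ => gaussianReal 0 1) ∂(P.map X) := by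
        rw [hjoint, integral_prod _ hint]
    _ = ∫ ω, ∫ z, F (X ω, z) ∂(Measure.pi fun _ => gaussianReal 0 1) ∂P :=
        integral_map hX.aemeasurable hint.integral_prod_left.aestronglyMeasurable
    _ = ∫ ω, (Q (avgStep s (X ω) - b) ⬝ᵥ Q (avgStep s (X ω) - b) +
          1 / (N : ℝ) * ∑ j, (Q (unit j) ⬝ᵥ Q (unit j)) * sampleVar s (X ω) j) ∂P :=
        integral_congr_ae (Filter.Eventually.of_forall fun ω => by
          simp only [hFdef]
          exact integral_mcStep_sq hN s Q (X ω) b)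
    _ = _ := by
        rw [integral_add hint1 ((integrable_finsetSum _ fun j _ => hint2 j).const_mul _),
          integral_const_mul, integral_finsetSum _ fun j _ => hint2 j]
        simp only [integral_const_mul]

end MonteCarloStep

/-! ### The error of the scheme as a sum over time steps -/

section ErrorFormula

theorem mcScheme_succ {M N : ℕ} (δt : ℝ) (w : Fin M → ℝ) (ξ : ℕ → Fin N → Fin M → ℝ) (n : ℕ) :
    mcScheme δt w ξ (n + 1) = mcStep √δt (mcScheme δt w ξ n) fun a => ξ n a.1 a.2 := rfl

theorem meanScheme_succ {M : ℕ} (δt : ℝ) (w : Fin M → ℝ) (n : ℕ) :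
    meanScheme δt w (n + 1) = avgStep √δt (meanScheme δt w n) := rfl

theorem mcScheme_congr {M N : ℕ} (δt : ℝ) (w : Fin M → ℝ) {ξ ξ' : ℕ → Fin N → Fin M → ℝ} {n : ℕ}
    (h : ∀ i < n, ∀ m j, ξ i m j = ξ' i m j) : mcScheme δt w ξ n = mcScheme δt w ξ' n := by
  induction n with
  | zero => rfl
  | succ n ih =>
    rw [mcScheme_succ, mcScheme_succ, ih fun i hi => h i (hi.trans n.lt_succ_self)]
    congr 1
    funext a
    exact h n n.lt_succ_self _ _

variable {M N : ℕ} [NeZero M]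

theorem abs_mcScheme_le (hN : 1 ≤ N) (δt : ℝ) {w : Fin M → ℝ} {R : ℝ} (hR : ∀ k, |w k| ≤ R)
    (ξ : ℕ → Fin N → Fin M → ℝ) (n : ℕ) (k : Fin M) : |mcScheme δt w ξ n k| ≤ R := by
  induction n generalizing k with
  | zero => exact hR k
  | succ n ih =>
    rw [mcScheme_succ]
    exact abs_mcStep_le hN _ ih _ k

theorem mcScheme_sub_const (hN : 1 ≤ N) (δt : ℝ) (w : Fin M → ℝ) (c : ℝ)
    (ξ : ℕ → Fin N → Fin M → ℝ) (n : ℕ) :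
    mcScheme δt (w - fun _ => c) ξ n = mcScheme δt w ξ n - fun _ => c := by
  have hN' : (N : ℝ) ≠ 0 := by exact_mod_cast (by omega : N ≠ 0)
  induction n with
  | zero => rfl
  | succ n ih =>
    rw [mcScheme_succ, mcScheme_succ, ih]
    funext j
    simp only [mcStep, interp_sub, interp_const, Pi.sub_apply, Finset.sum_sub_distrib, mul_sub]
    simp [hN']

theorem meanScheme_sub_const (δt : ℝ) (w : Fin M → ℝ) (c : ℝ) (n : ℕ) :
    meanScheme δt (w - fun _ => c) n = meanScheme δt w n - fun _ => c := by
  induction n with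
  | zero => rfl
  | succ n ih => rw [meanScheme_succ, meanScheme_succ, ih, map_sub, avgStep_const]

theorem meanScheme_contraction (δt : ℝ) (w : Fin M → ℝ) (n : ℕ) :
    meanScheme δt w n ⬝ᵥ meanScheme δt w n ≤ w ⬝ᵥ w := by
  induction n with
  | zero => rfl
  | succ n ih => exact (avgStep_contraction _ _).trans ih

theorem gradSq_meanScheme_le (δt : ℝ) (w : Fin M → ℝ) (n : ℕ) :
    gradSq (meanScheme δt w n) ≤ gradSq w := by
  induction n with
  | zero => rfl
  | succ n ih => exact (gradSq_avgStep_le _ _).trans ih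

variable {Ω : Type*} [MeasurableSpace Ω] {P : Measure Ω} [IsProbabilityMeasure P]
  {ξ : ℕ → Fin N → Fin M → Ω → ℝ}

theorem measurable_mcScheme (hξ : ∀ n m j, Measurable (ξ n m j)) (δt : ℝ) (w : Fin M → ℝ) (n : ℕ) :
    Measurable fun ω => mcScheme δt w (fun i m j => ξ i m j ω) n := by
  induction n with
  | zero => exact measurable_const
  | succ n ih =>
    simp only [mcScheme_succ]
    exact Measurable.comp (g := fun q : (Fin M → ℝ) × (Fin N × Fin M → ℝ) => mcStep √δt q.1 q.2)
      (f := fun ω => (mcScheme δt w (fun i m j => ξ i m j ω) n, fun a => ξ n a.1 a.2 ω))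
      (measurable_mcStep _) (ih.prodMk (measurable_pi_lambda _ fun a => hξ n a.1 a.2))

/-- The state at time `n` is a function of the noise before `n`, so it is independent of the noise
of the step `n`. -/
theorem indepFun_mcScheme {P : Measure Ω} (hξ : ∀ n m j, Measurable (ξ n m j)) {MT : ℕ}
    (hG : IsGaussianNoise P MT ξ) (δt : ℝ) (w : Fin M → ℝ) {n : ℕ} (hn : n < MT) :
    IndepFun (fun ω => mcScheme δt w (fun i m j => ξ i m j ω) n)
      (fun ω (a : Fin N × Fin M) => ξ n a.1 a.2 ω) P := by
  classical
  let S : Finset (Fin MT × Fin N × Fin M) := {i | (i.1 : ℕ) < n}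
  let S' : Finset (Fin MT × Fin N × Fin M) := {i | (i.1 : ℕ) = n}
  have hdisj : Disjoint S S' := by
    rw [Finset.disjoint_left]
    intro i hi hi'
    simp only [S, S', Finset.mem_filter, Finset.mem_univ, true_and] at hi hi'
    omega
  have h := hG.2.indepFun_finset S S' hdisj fun i => hξ _ _ _
  -- The noise before `n`, continued by zero, read off from the tuple indexed by `S`.
  let ext : ℕ → Fin N → Fin M → (S → ℝ) → ℝ := fun i m j y =>
    if hi : i < n then
      y ⟨(⟨i, hi.trans hn⟩, m, j), by
        simp only [S, Finset.mem_filter, Finset.mem_univ, true_and]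
        exact hi⟩
    else 0
  have hext : ∀ i m j, Measurable (ext i m j) := fun i m j => by
    by_cases hi : i < n
    · simp only [ext, hi, dite_true]
      exact measurable_pi_apply _
    · simp only [ext, hi, dite_false]
      exact measurable_const
  have hpast := measurable_mcScheme (ξ := ext) hext δt w n
  let pick : (S' → ℝ) → Fin N × Fin M → ℝ := fun y a =>
    y ⟨(⟨n, hn⟩, a.1, a.2), by simp only [S', Finset.mem_filter, Finset.mem_univ, true_and]⟩
  have hpick : Measurable pick := measurable_pi_lambda _ fun a => measurable_pi_apply _
  have h2 := h.comp hpast hpick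
  have h3 : (fun ω => mcScheme δt w (fun i m j => ξ i m j ω) n) =
      (fun y : S → ℝ => mcScheme δt w (fun i m j => ext i m j y) n) ∘
        fun ω (i : S) => ξ (i.1.1 : ℕ) i.1.2.1 i.1.2.2 ω := by
    funext ω
    refine mcScheme_congr δt w fun i hi m j => ?_
    simp only [ext, hi, dite_true]
  rw [h3]
  exact h2

theorem map_noise {M N : ℕ} {ξ : ℕ → Fin N → Fin M → Ω → ℝ} {MT : ℕ}
    (hG : IsGaussianNoise P MT ξ) {n : ℕ} (hn : n < MT) :
    P.map (fun ω (a : Fin N × Fin M) => ξ n a.1 a.2 ω) =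
      Measure.pi fun _ => gaussianReal 0 1 := by
  have h := hG.2.precomp (g := fun a : Fin N × Fin M => ((⟨n, hn⟩ : Fin MT), a.1, a.2))
    (fun a b hab => by simpa [Prod.ext_iff] using hab)
  rw [(iIndepFun_iff_map_fun_eq_pi_map (f := fun a : Fin N × Fin M => ξ n a.1 a.2)
    fun a => (hG.1 n hn a.1 a.2).aemeasurable).1 h]
  congr 1
  funext a
  exact (hG.1 n hn a.1 a.2).map_eq

/-- The total sampling variance of step `n`. -/
noncomputable def stepVar {M N : ℕ} (P : Measure Ω) (δt : ℝ) (w : Fin M → ℝ)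
    (ξ : ℕ → Fin N → Fin M → Ω → ℝ) (n : ℕ) : ℝ :=
  ∑ j, ∫ ω, sampleVar √δt (mcScheme δt w (fun i m j => ξ i m j ω) n) j ∂P

theorem stepVar_nonneg {M N : ℕ} {P : Measure Ω} {ξ : ℕ → Fin N → Fin M → Ω → ℝ}
    (δt : ℝ) (w : Fin M → ℝ) (n : ℕ) : 0 ≤ stepVar P δt w ξ n :=
  Finset.sum_nonneg fun _ _ => integral_nonneg fun _ => sampleVar_nonneg _ _ _

/-- The mean square error at time `n`, summed over the nodes. -/
noncomputable def meanSqError {M N : ℕ} (P : Measure Ω) (δt : ℝ) (w : Fin M → ℝ)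
    (ξ : ℕ → Fin N → Fin M → Ω → ℝ) (n : ℕ) : ℝ :=
  ∫ ω, (mcScheme δt w (fun i m j => ξ i m j ω) n - meanScheme δt w n) ⬝ᵥ
    (mcScheme δt w (fun i m j => ξ i m j ω) n - meanScheme δt w n) ∂P

theorem integrable_dotProduct_mcScheme (hN : 1 ≤ N) (hξ : ∀ n m j, Measurable (ξ n m j)) (δt : ℝ)
    (w b : Fin M → ℝ) (n : ℕ) (Q : (Fin M → ℝ) →ₗ[ℝ] (Fin M → ℝ)) :
    Integrable (fun ω => Q (mcScheme δt w (fun i m j => ξ i m j ω) n - b) ⬝ᵥ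
      Q (mcScheme δt w (fun i m j => ξ i m j ω) n - b)) P := by
  obtain ⟨R, hR⟩ := exists_abs_le w
  obtain ⟨Rb, hRb⟩ := exists_abs_le b
  exact integrable_dotProduct_linearMap ((measurable_mcScheme hξ δt w n).sub measurable_const)
    (fun ω k => (abs_sub _ _).trans (add_le_add (abs_mcScheme_le hN δt hR _ n k) (hRb k))) Q

theorem integrable_sampleVar_mcScheme (hN : 1 ≤ N) (hξ : ∀ n m j, Measurable (ξ n m j)) (δt : ℝ)
    (w : Fin M → ℝ) (n : ℕ) (j : Fin M) :
    Integrable (fun ω => sampleVar √δt (mcScheme δt w (fun i m j => ξ i m j ω) n) j) P := by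
  obtain ⟨R, hR⟩ := exists_abs_le w
  exact integrable_sampleVar (measurable_mcScheme hξ δt w n)
    (fun ω => abs_mcScheme_le hN δt hR _ n) _ j

theorem integral_mcScheme_succ (hN : 1 ≤ N) (hξ : ∀ n m j, Measurable (ξ n m j)) {MT : ℕ}
    (hG : IsGaussianNoise P MT ξ) (δt : ℝ) (w b : Fin M → ℝ) {n : ℕ} (hn : n < MT) (m : ℕ) :
    ∫ ω, (avgStep √δt ^ m) (mcScheme δt w (fun i m j => ξ i m j ω) (n + 1) - b) ⬝ᵥ
        (avgStep √δt ^ m) (mcScheme δt w (fun i m j => ξ i m j ω) (n + 1) - b) ∂P =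
      ∫ ω, (avgStep √δt ^ m) (avgStep √δt (mcScheme δt w (fun i m j => ξ i m j ω) n) - b) ⬝ᵥ
        (avgStep √δt ^ m) (avgStep √δt (mcScheme δt w (fun i m j => ξ i m j ω) n) - b) ∂P +
      1 / (N : ℝ) * (kernelSq M √δt m * stepVar P δt w ξ n) := by
  obtain ⟨R, hR⟩ := exists_abs_le w
  have h := integral_mcStep_sq_of_indep hN √δt (avgStep √δt ^ m) b
    (measurable_mcScheme hξ δt w n) (fun ω => abs_mcScheme_le hN δt hR _ n)
    (measurable_pi_lambda _ fun a : Fin N × Fin M => hξ n a.1 a.2) (map_noise hG hn)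
    (indepFun_mcScheme hξ hG δt w hn)
  simp only [dotProduct_avgStep_pow_unit, ← Finset.mul_sum] at h
  exact h

/-- The errors made at different time steps are orthogonal, and the error made at step `l` is
damped by the `n - 1 - l` averaged steps that follow it. -/
theorem meanSqError_eq (hN : 1 ≤ N) (hξ : ∀ n m j, Measurable (ξ n m j)) {MT : ℕ}
    (hG : IsGaussianNoise P MT ξ) (δt : ℝ) (w : Fin M → ℝ) {n : ℕ} (hn : n ≤ MT) :
    meanSqError P δt w ξ n =
      1 / (N : ℝ) * ∑ l ∈ Finset.range n, kernelSq M √δt (n - 1 - l) * stepVar P δt w ξ l := by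
  have key : ∀ n ≤ MT, ∀ m : ℕ,
      ∫ ω, (avgStep √δt ^ m)
          (mcScheme δt w (fun i m j => ξ i m j ω) n - meanScheme δt w n) ⬝ᵥ
        (avgStep √δt ^ m)
          (mcScheme δt w (fun i m j => ξ i m j ω) n - meanScheme δt w n) ∂P =
      1 / (N : ℝ) *
        ∑ l ∈ Finset.range n, kernelSq M √δt (m + n - 1 - l) * stepVar P δt w ξ l := by
    intro n
    induction n with
    | zero => intro _ m; simp [mcScheme, meanScheme]
    | succ n ih =>
      intro hn m
      rw [integral_mcScheme_succ hN hξ hG δt w _ (by omega), Finset.sum_range_succ, mul_add]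
      congr 1
      · have h := ih (by omega) (m + 1)
        simp only [pow_succ, Module.End.mul_apply, map_sub (avgStep √δt), ← meanScheme_succ] at h
        rw [h, show m + 1 + n = m + (n + 1) by ring]
      · rw [show m + (n + 1) - 1 - n = m by omega]
  have h := key n hn 0
  simp only [pow_zero, Module.End.one_apply, zero_add] at h
  exact h

/-- The energy balance: the sampling variance is paid for by the dissipation of the averaged
step, up to the factor `1 / N`. -/
theorem integral_mcScheme_energy (hN : 1 ≤ N) (hξ : ∀ n m j, Measurable (ξ n m j)) {MT : ℕ}
    (hG : IsGaussianNoise P MT ξ) (δt : ℝ) (w : Fin M → ℝ) {n : ℕ} (hn : n ≤ MT) :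
    ∫ ω, mcScheme δt w (fun i m j => ξ i m j ω) n ⬝ᵥ
        mcScheme δt w (fun i m j => ξ i m j ω) n ∂P +
      (1 - 1 / (N : ℝ)) * ∑ l ∈ Finset.range n, stepVar P δt w ξ l ≤ w ⬝ᵥ w := by
  induction n with
  | zero => simp [mcScheme]
  | succ n ih =>
    have h := integral_mcScheme_succ hN hξ hG δt w 0 (n := n) (by omega) 0
    have hk : kernelSq M √δt 0 = 1 := by simp [kernelSq, unit]
    simp only [pow_zero, Module.End.one_apply, sub_zero, hk, one_mul] at h
    have hi1 := integrable_dotProduct_mcScheme (P := P) hN hξ δt w 0 n 1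
    have hi2 := integrable_dotProduct_mcScheme (P := P) hN hξ δt w 0 n (avgStep √δt)
    simp only [Module.End.one_apply, sub_zero] at hi1 hi2
    have hV : stepVar P δt w ξ n ≤
        ∫ ω, mcScheme δt w (fun i m j => ξ i m j ω) n ⬝ᵥ
          mcScheme δt w (fun i m j => ξ i m j ω) n ∂P -
        ∫ ω, avgStep √δt (mcScheme δt w (fun i m j => ξ i m j ω) n) ⬝ᵥ
          avgStep √δt (mcScheme δt w (fun i m j => ξ i m j ω) n) ∂P := by
      rw [← integral_sub hi1 hi2, stepVar,
        ← integral_finsetSum _ fun j _ => integrable_sampleVar_mcScheme hN hξ δt w n j]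
      exact integral_mono
        (integrable_finsetSum _ fun j _ => integrable_sampleVar_mcScheme hN hξ δt w n j)
        (hi1.sub hi2) fun ω => sum_sampleVar_le _ _
    have := ih (by omega)
    rw [Finset.sum_range_succ, h]
    linarith

/-- The bound of order `1 / N` by the size of the initial datum. -/
theorem meanSqError_le_energy (hN : 1 ≤ N) (hξ : ∀ n m j, Measurable (ξ n m j)) {MT : ℕ}
    (hG : IsGaussianNoise P MT ξ) (δt : ℝ) (w : Fin M → ℝ) {n : ℕ} (hn : n ≤ MT) :
    meanSqError P δt w ξ n ≤ 4 / N * (w ⬝ᵥ w) := by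
  have hE := integral_mcScheme_energy hN hξ hG δt w hn
  have hVn : ∀ l, 0 ≤ stepVar P δt w ξ l := fun l => stepVar_nonneg δt w l
  have hS : 0 ≤ ∑ l ∈ Finset.range n, stepVar P δt w ξ l := Finset.sum_nonneg fun l _ => hVn l
  have hw := dotProduct_self_nonneg' w
  rcases hN.eq_or_lt with rfl | hN2
  · have hi1 := integrable_dotProduct_mcScheme (P := P) hN hξ δt w 0 n 1
    have hi2 := integrable_dotProduct_mcScheme (P := P) hN hξ δt w (meanScheme δt w n) n 1
    simp only [Module.End.one_apply, sub_zero] at hi1 hi2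
    have h1 : meanSqError P δt w ξ n ≤
        ∫ ω, (2 * (mcScheme δt w (fun i m j => ξ i m j ω) n ⬝ᵥ
          mcScheme δt w (fun i m j => ξ i m j ω) n) +
          2 * (meanScheme δt w n ⬝ᵥ meanScheme δt w n)) ∂P := by
      refine integral_mono hi2 ((hi1.const_mul 2).add (integrable_const _)) fun ω => ?_
      simp only [dotProduct, Finset.mul_sum, ← Finset.sum_add_distrib, Pi.sub_apply]
      refine Finset.sum_le_sum fun k _ => ?_
      nlinarith [sq_nonneg (mcScheme δt w (fun i m j => ξ i m j ω) n k + meanScheme δt w n k)]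
    rw [integral_add (hi1.const_mul 2) (integrable_const _), integral_const_mul,
      integral_const] at h1
    have := meanScheme_contraction δt w n
    simp only [probReal_univ, one_smul] at h1
    norm_num at hE ⊢
    linarith
  · have hN' : (2 : ℝ) ≤ N := by exact_mod_cast hN2
    have hhalf : 1 / (N : ℝ) ≤ 1 / 2 := one_div_le_one_div_of_le two_pos hN'
    have ha : 0 ≤ ∫ ω, mcScheme δt w (fun i m j => ξ i m j ω) n ⬝ᵥ
        mcScheme δt w (fun i m j => ξ i m j ω) n ∂P :=
      integral_nonneg fun ω => dotProduct_self_nonneg' _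
    have hsum : ∑ l ∈ Finset.range n, stepVar P δt w ξ l ≤ 2 * (w ⬝ᵥ w) := by nlinarith
    rw [meanSqError_eq hN hξ hG δt w hn]
    have : ∑ l ∈ Finset.range n, kernelSq M √δt (n - 1 - l) * stepVar P δt w ξ l ≤
        4 * (w ⬝ᵥ w) := by
      refine (Finset.sum_le_sum fun l _ =>
        mul_le_of_le_one_left (hVn l) (kernelSq_le_one _ _)).trans ?_
      linarith
    calc 1 / (N : ℝ) * _ ≤ 1 / (N : ℝ) * (4 * (w ⬝ᵥ w)) :=
          mul_le_mul_of_nonneg_left this (by positivity)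
      _ = 4 / N * (w ⬝ᵥ w) := by ring

/-- Splitting the state into the averaged solution, whose gradient is under control, and the
error, which can be fed back. -/
theorem stepVar_le (hN : 1 ≤ N) (hξ : ∀ n m j, Measurable (ξ n m j)) {δt : ℝ} (hδ : 0 < δt)
    (w : Fin M → ℝ) (n : ℕ) :
    stepVar P δt w ξ n ≤ 2 * (δt / dx M ^ 2 * gradSq w) + 2 * meanSqError P δt w ξ n := by
  have hi := integrable_dotProduct_mcScheme (P := P) hN hξ δt w (meanScheme δt w n) n 1
  simp only [Module.End.one_apply] at hi
  have hd := dx_pos (M := M)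
  rw [stepVar, ← integral_finsetSum _ fun j _ => integrable_sampleVar_mcScheme hN hξ δt w n j]
  refine (integral_mono
    (g := fun ω => 2 * (δt / dx M ^ 2 * gradSq w) +
      2 * ((mcScheme δt w (fun i m j => ξ i m j ω) n - meanScheme δt w n) ⬝ᵥ
        (mcScheme δt w (fun i m j => ξ i m j ω) n - meanScheme δt w n)))
    (integrable_finsetSum _ fun j _ => integrable_sampleVar_mcScheme hN hξ δt w n j)
    ((integrable_const _).add (hi.const_mul 2)) fun ω => ?_).trans_eq ?_
  · set u := mcScheme δt w (fun i m j => ξ i m j ω) n with hu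
    set v := meanScheme δt w n with hv
    have h1 : ∀ j, sampleVar √δt u j ≤ 2 * sampleVar √δt v j + 2 * sampleVar √δt (u - v) j :=
      fun j => by simpa using sampleVar_add_le √δt v (u - v) j
    have h2 := sum_sampleVar_le_gradSq √δt v
    rw [Real.sq_sqrt hδ.le] at h2
    have h3 := sum_sampleVar_le_self √δt (u - v)
    have h4 : δt / dx M ^ 2 * gradSq v ≤ δt / dx M ^ 2 * gradSq w :=
      mul_le_mul_of_nonneg_left (gradSq_meanScheme_le δt w n) (by positivity)
    refine (Finset.sum_le_sum fun j _ => h1 j).trans ?_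
    rw [Finset.sum_add_distrib, ← Finset.mul_sum, ← Finset.mul_sum]
    linarith
  · rw [integral_add (integrable_const _) (hi.const_mul 2), integral_const, probReal_univ, one_smul,
      integral_const_mul, meanSqError]

end ErrorFormula

/-! ### The Monte-Carlo error bound -/

section MonteCarloBound

theorem dt_pos {T : ℝ} (hT : 0 < T) {MT : ℕ} (hMT : 1 ≤ MT) : 0 < dt T MT :=
  div_pos hT (by exact_mod_cast hMT)

theorem natCast_mul_dt_le {T : ℝ} (hT : 0 < T) {MT n : ℕ} (hMT : 1 ≤ MT) (hn : n ≤ MT) :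
    n * dt T MT ≤ T := by
  have h1 : (0 : ℝ) < MT := by exact_mod_cast hMT
  have h2 : (n : ℝ) ≤ MT := by exact_mod_cast hn
  rw [dt, mul_div_assoc', div_le_iff₀ h1, mul_comm]
  exact mul_le_mul_of_nonneg_left h2 hT.le

variable {M N : ℕ} [NeZero M]

theorem h1SeminormSq_eq (w : Fin M → ℝ) : h1SeminormSq w = dx M * (gradSq w / dx M ^ 2) := by
  rw [h1SeminormSq, gradSq_eq_sum, Finset.sum_div]

variable {Ω : Type*} [MeasurableSpace Ω] {P : Measure Ω} [IsProbabilityMeasure P]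
  {ξ : ℕ → Fin N → Fin M → Ω → ℝ}

/-- The factor `1 + δx/δt + δx²/δt² (1 + |log δt|)` of the error bound. -/
noncomputable def ratioFactor (δx δt : ℝ) : ℝ :=
  1 + δx / δt + δx ^ 2 / δt ^ 2 * (1 + |Real.log δt|)

theorem le_ratioFactor {δx δt : ℝ} : 1 + δx / δt + δx ^ 2 / δt ^ 2 ≤ ratioFactor δx δt := by
  have h : 0 ≤ δx ^ 2 / δt ^ 2 * |Real.log δt| := by positivity
  rw [ratioFactor]
  linarith

theorem one_le_ratioFactor {δx δt : ℝ} (hx : 0 < δx) (ht : 0 < δt) : 1 ≤ ratioFactor δx δt := by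
  have h : 0 ≤ δx / δt + δx ^ 2 / δt ^ 2 * (1 + |Real.log δt|) := by positivity
  rw [ratioFactor]
  linarith

/-- The constant of the error bound of order `p`. -/
noncomputable def errorConst (T : ℝ) : ℕ → ℝ
  | 0 => 4
  | p + 1 => 4 * (T + 1) * (1 + errorConst T p)

theorem errorConst_pos {T : ℝ} (hT : 0 ≤ T) (p : ℕ) : 0 < errorConst T p := by
  induction p with
  | zero => simp [errorConst]
  | succ p ih =>
    rw [errorConst]
    positivity

/-- The bound of order `1 / N` by the discrete `H¹` semi-norm: the error does not change when a
constant is subtracted from the initial datum. -/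
theorem meanSqError_le_gradSq (hN : 1 ≤ N) (hξ : ∀ n m j, Measurable (ξ n m j)) {MT : ℕ}
    (hG : IsGaussianNoise P MT ξ) (δt : ℝ) (w : Fin M → ℝ) {n : ℕ} (hn : n ≤ MT) :
    meanSqError P δt w ξ n ≤ 4 / N * (gradSq w / dx M ^ 2) := by
  have h := meanSqError_le_energy hN hξ hG δt (w - fun _ => w 0) hn
  have h1 : meanSqError P δt (w - fun _ => w 0) ξ n = meanSqError P δt w ξ n := by
    simp only [meanSqError, mcScheme_sub_const hN, meanScheme_sub_const, sub_sub_sub_cancel_right]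
  have h2 : (w - fun _ => w 0) ⬝ᵥ (w - fun _ => w 0) ≤ gradSq w / dx M ^ 2 := by
    have h3 : ∀ j ∈ Finset.univ, (w j - w 0) * (w j - w 0) ≤ M * gradSq w :=
      fun j _ => by
        rw [← sq]
        exact sub_sq_le_gradSq w j 0
    refine (Finset.sum_le_card_nsmul _ _ _ h3).trans_eq ?_
    have := gridSize_pos (M := M)
    simp only [Finset.card_univ, Fintype.card_fin, nsmul_eq_mul, dx]
    field_simp
  rw [h1] at h
  exact h.trans (mul_le_mul_of_nonneg_left h2 (by positivity))

/-- The error formula turns a bound of the error into a better one: a factor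
`1 / N` is gained at the price of one factor `ratioFactor`. -/
theorem meanSqError_le (hN : 1 ≤ N) (hξ : ∀ n m j, Measurable (ξ n m j)) {T : ℝ} (hT : 0 < T)
    {MT : ℕ} (hMT : 1 ≤ MT) (hG : IsGaussianNoise P MT ξ) (w : Fin M → ℝ) (p : ℕ) {n : ℕ}
    (hn : n ≤ MT) :
    meanSqError P (dt T MT) w ξ n ≤
      errorConst T p * (gradSq w / dx M ^ 2) *
        ratioFactor (dx M) (dt T MT) ^ p * (dt T MT / N + 1 / (N : ℝ) ^ (p + 1)) := by
  have hNpos : (1 : ℝ) ≤ N := by exact_mod_cast hN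
  have hN0 : (0 : ℝ) < N := by linarith
  have hδ := dt_pos hT hMT
  have hd := dx_pos (M := M)
  have hH : 0 ≤ gradSq w / dx M ^ 2 := div_nonneg (gradSq_nonneg w) (by positivity)
  have hB := one_le_ratioFactor hd hδ
  induction p generalizing n with
  | zero =>
    refine (meanSqError_le_gradSq hN hξ hG _ w hn).trans ?_
    have h : (1 : ℝ) / N ≤ dt T MT / N + 1 / (N : ℝ) ^ (0 + 1) := by
      rw [zero_add, pow_one]
      have : 0 ≤ dt T MT / N := by positivity
      linarith
    have := mul_le_mul_of_nonneg_left h (mul_nonneg zero_le_four hH)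
    calc 4 / (N : ℝ) * (gradSq w / dx M ^ 2) = 4 * (gradSq w / dx M ^ 2) * (1 / N) := by ring
      _ ≤ _ := by simpa [errorConst] using this
  | succ p ih =>
    rw [errorConst]
    set C := errorConst T p with hC
    set δt := dt T MT
    set B := ratioFactor (dx M) δt with hBdef
    set H := gradSq w / dx M ^ 2 with hHdef
    set X := δt / N + 1 / (N : ℝ) ^ (p + 1) with hX
    have hC0 : 0 ≤ C := (errorConst_pos hT.le p).le
    have hX0 : 0 ≤ X := by positivity
    have hBp : 1 ≤ B ^ p := one_le_pow₀ hB
    have hS : ∀ l ∈ Finset.range n, kernelSq M √δt (n - 1 - l) * stepVar P δt w ξ l ≤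
        kernelSq M √δt (n - 1 - l) * (2 * H * B ^ p * (δt + C * X)) := fun l hl => by
      refine mul_le_mul_of_nonneg_left ?_ (kernelSq_nonneg _ _)
      have h1 := stepVar_le (P := P) hN hξ hδ w l
      have h2 := ih (n := l) ((Finset.mem_range.1 hl).le.trans hn)
      have h3 : δt / dx M ^ 2 * gradSq w = H * δt := by rw [hHdef]; ring
      have h4 : H * δt * 1 ≤ H * δt * B ^ p := mul_le_mul_of_nonneg_left hBp (by positivity)
      rw [h3] at h1
      linarith
    have hK : ∑ l ∈ Finset.range n, kernelSq M √δt (n - 1 - l) ≤ 2 * (T + 1) * B := by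
      rw [Finset.sum_range_reflect (fun m => kernelSq M √δt m) n]
      refine (sum_kernelSq_le_of_time hT hδ (natCast_mul_dt_le hT hMT hn)).trans ?_
      exact mul_le_mul_of_nonneg_left le_ratioFactor (by positivity)
    have hXN : X / N ≤ δt / N + 1 / (N : ℝ) ^ (p + 1 + 1) := by
      rw [hX, add_div, div_div, div_div, ← pow_succ]
      gcongr
      nlinarith
    rw [meanSqError_eq hN hξ hG _ w hn]
    calc 1 / (N : ℝ) * ∑ l ∈ Finset.range n, kernelSq M √δt (n - 1 - l) * stepVar P δt w ξ l
        ≤ 1 / (N : ℝ) * (2 * (T + 1) * B * (2 * H * B ^ p * (δt + C * X))) := by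
          refine mul_le_mul_of_nonneg_left ((Finset.sum_le_sum hS).trans ?_) (by positivity)
          rw [← Finset.sum_mul]
          exact mul_le_mul_of_nonneg_right hK (by positivity)
      _ = 4 * (T + 1) * H * B ^ (p + 1) * (δt / N + C * (X / N)) := by
          rw [pow_succ]
          ring
      _ ≤ 4 * (T + 1) * H * B ^ (p + 1) *
            ((1 + C) * (δt / N + 1 / (N : ℝ) ^ (p + 1 + 1))) := by
          refine mul_le_mul_of_nonneg_left ?_ (by positivity)
          have h1 : δt / N ≤ δt / N + 1 / (N : ℝ) ^ (p + 1 + 1) := by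
            have : 0 ≤ 1 / (N : ℝ) ^ (p + 1 + 1) := by positivity
            linarith
          have h2 := mul_le_mul_of_nonneg_left hXN hC0
          linarith
      _ = _ := by ring

end MonteCarloBound

section MonteCarloError

variable {M N : ℕ} [NeZero M]
variable {Ω : Type*} [MeasurableSpace Ω] {P : Measure Ω} [IsProbabilityMeasure P]
  {ξ : ℕ → Fin N → Fin M → Ω → ℝ}

/-- The noise may be replaced by a measurable version, without changing the law of the scheme up to
time `MT`. -/
theorem exists_measurable_noise {M N : ℕ} {P : Measure Ω} {ξ : ℕ → Fin N → Fin M → Ω → ℝ}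
    {MT : ℕ} (hG : IsGaussianNoise P MT ξ) :
    ∃ ξ' : ℕ → Fin N → Fin M → Ω → ℝ, (∀ n m j, Measurable (ξ' n m j)) ∧
      IsGaussianNoise P MT ξ' ∧ ∀ᵐ ω ∂P, ∀ n < MT, ∀ m j, ξ n m j ω = ξ' n m j ω := by
  classical
  let ξ' : ℕ → Fin N → Fin M → Ω → ℝ := fun n m j =>
    if h : n < MT then (hG.1 n h m j).aemeasurable.mk _ else 0
  have hae : ∀ n < MT, ∀ m j, ξ n m j =ᵐ[P] ξ' n m j := fun n h m j => by
    simp only [ξ', h, dite_true]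
    exact (hG.1 n h m j).aemeasurable.ae_eq_mk
  have hm : ∀ n m j, Measurable (ξ' n m j) := fun n m j => by
    by_cases h : n < MT
    · simp only [ξ', h, dite_true]
      exact (hG.1 n h m j).aemeasurable.measurable_mk
    · simp only [ξ', h, dite_false]
      exact measurable_const
  refine ⟨ξ', hm, ⟨fun n h m j => ⟨(hm n m j).aemeasurable, ?_⟩,
    hG.2.congr fun i => hae i.1 i.1.2 i.2.1 i.2.2⟩, ?_⟩
  · rw [← Measure.map_congr (hae n h m j)]
    exact (hG.1 n h m j).map_eq
  · refine ae_all_iff.2 fun n => ?_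
    by_cases h : n < MT
    · filter_upwards [ae_all_iff.2 fun m => ae_all_iff.2 fun j => hae n h m j] with ω hω _
      exact hω
    · exact Filter.Eventually.of_forall fun ω h' => absurd h' h

theorem ell2NormSq_eq {M : ℕ} (w : Fin M → ℝ) : ell2NormSq w = dx M * (w ⬝ᵥ w) := by
  simp [ell2NormSq, dotProduct, sq]

theorem monteCarlo_error_le {T : ℝ} (hT : 0 < T) (p : ℕ) {MT : ℕ} (hMT : 1 ≤ MT) (hN : 1 ≤ N)
    (hG : IsGaussianNoise P MT ξ) (w : Fin M → ℝ) {n : ℕ} (hn : n ≤ MT) :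
    Integrable (fun ω => ell2NormSq (mcScheme (dt T MT) w (fun i m j => ξ i m j ω) n -
        meanScheme (dt T MT) w n)) P ∧
      ∫ ω, ell2NormSq (mcScheme (dt T MT) w (fun i m j => ξ i m j ω) n -
        meanScheme (dt T MT) w n) ∂P ≤
      errorConst T p * h1SeminormSq w *
        ratioFactor (dx M) (dt T MT) ^ p * (dt T MT / N + 1 / (N : ℝ) ^ (p + 1)) := by
  obtain ⟨ξ', hm, hG', hae⟩ := exists_measurable_noise hG
  have hcongr : (fun ω => ell2NormSq (mcScheme (dt T MT) w (fun i m j => ξ i m j ω) n -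
      meanScheme (dt T MT) w n)) =ᵐ[P] fun ω => dx M *
        ((mcScheme (dt T MT) w (fun i m j => ξ' i m j ω) n - meanScheme (dt T MT) w n) ⬝ᵥ
          (mcScheme (dt T MT) w (fun i m j => ξ' i m j ω) n - meanScheme (dt T MT) w n)) := by
    filter_upwards [hae] with ω hω
    rw [ell2NormSq_eq, mcScheme_congr (dt T MT) w fun i hi m j => hω i (hi.trans_le hn) m j]
  have hi := integrable_dotProduct_mcScheme (P := P) hN hm (dt T MT) w
    (meanScheme (dt T MT) w n) n 1
  simp only [Module.End.one_apply] at hi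
  refine ⟨(hi.const_mul _).congr hcongr.symm, ?_⟩
  rw [integral_congr_ae hcongr, integral_const_mul, h1SeminormSq_eq]
  have h := mul_le_mul_of_nonneg_left (meanSqError_le hN hm hT hMT hG' w p hn) (dx_pos (M := M)).le
  refine h.trans_eq ?_
  ring

end MonteCarloError

/-! ### The Gaussian average of a periodic function -/

section GaussianAverage

/-- The Gaussian average `𝔼[f (x + √t Z)]`. -/
noncomputable def gaussAvg (f : ℝ → ℝ) (t x : ℝ) : ℝ :=
  ∫ z, f (x + √t * z) ∂(gaussianReal 0 1)

theorem integrable_of_abs_le {f : ℝ → ℝ} (hf : Continuous f) {K : ℝ} (hK : ∀ y, |f y| ≤ K)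
    (x s : ℝ) : Integrable (fun z => f (x + s * z)) (gaussianReal 0 1) :=
  (memLp_two_of_bounded (by fun_prop) (R := K) fun z => hK _).integrable one_le_two

theorem abs_gaussAvg_le {f : ℝ → ℝ} {K : ℝ} (hK : ∀ y, |f y| ≤ K) (t x : ℝ) :
    |gaussAvg f t x| ≤ K := by
  have h := norm_integral_le_of_norm_le_const (μ := gaussianReal 0 1)
    (f := fun z => f (x + √t * z)) (Filter.Eventually.of_forall fun z => hK (x + √t * z))
  simpa [gaussAvg] using h

theorem gaussAvg_zero (f : ℝ → ℝ) (x : ℝ) : gaussAvg f 0 x = f x := by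
  simp [gaussAvg]

theorem gaussAvg_periodic {f : ℝ → ℝ} (hf : Function.Periodic f 1) (t : ℝ) :
    Function.Periodic (gaussAvg f t) 1 := fun x => by
  simp only [gaussAvg]
  refine integral_congr_ae (Filter.Eventually.of_forall fun z => ?_)
  simp only
  rw [add_right_comm, hf]

theorem continuous_gaussAvg {f : ℝ → ℝ} (hf : Continuous f) {K : ℝ} (hK : ∀ y, |f y| ≤ K) :
    Continuous fun q : ℝ × ℝ => gaussAvg f q.1 q.2 := by
  refine continuous_of_dominated (bound := fun _ => K) ?_ ?_ (integrable_const _) ?_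
  · exact fun q => Continuous.aestronglyMeasurable (by fun_prop)
  · exact fun q => Filter.Eventually.of_forall fun z => hK _
  · exact Filter.Eventually.of_forall fun z => by fun_prop

theorem hasDerivAt_gaussAvg {f f' : ℝ → ℝ} (hf : ∀ y, HasDerivAt f (f' y) y) (hc : Continuous f')
    {K K' : ℝ} (hK : ∀ y, |f y| ≤ K) (hK' : ∀ y, |f' y| ≤ K') (t x : ℝ) :
    HasDerivAt (gaussAvg f t) (gaussAvg f' t x) x := by
  have hfc : Continuous f := continuous_iff_continuousAt.2 fun y => (hf y).continuousAt
  refine (hasDerivAt_integral_of_dominated_loc_of_deriv_le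
    (F := fun x z => f (x + √t * z)) (F' := fun x z => f' (x + √t * z)) (bound := fun _ => K')
    Filter.univ_mem ?_ (integrable_of_abs_le hfc hK _ _) ?_ ?_ (integrable_const _) ?_).2
  · exact Filter.Eventually.of_forall fun y => Continuous.aestronglyMeasurable (by fun_prop)
  · exact Continuous.aestronglyMeasurable (by fun_prop)
  · exact Filter.Eventually.of_forall fun z y _ => hK' _
  · exact Filter.Eventually.of_forall fun z y _ => (hf _).comp_add_const y (√t * z)

theorem integrable_id_gaussianReal : Integrable (fun z : ℝ => z) (gaussianReal 0 1) :=
  (memLp_id_gaussianReal (μ := 0) (v := 1) 2).integrable one_le_two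

theorem integrable_pdf_mul {g : ℝ → ℝ} (hg : Integrable g (gaussianReal 0 1)) :
    Integrable fun z => gaussianPDFReal 0 1 z * g z := by
  rw [gaussianReal_of_var_ne_zero 0 one_ne_zero, integrable_withDensity_iff_integrable_smul'
    (measurable_gaussianPDF 0 1) (Filter.Eventually.of_forall fun z => gaussianPDF_lt_top)] at hg
  simpa only [toReal_gaussianPDF, smul_eq_mul] using hg

theorem hasDerivAt_gaussianPDFReal (z : ℝ) :
    HasDerivAt (gaussianPDFReal 0 1) (-(gaussianPDFReal 0 1 z * z)) z := by
  have h : HasDerivAt (fun z : ℝ => -(z - 0) ^ 2 / (2 * ((1 : NNReal) : ℝ))) (-z) z := by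
    have := (((hasDerivAt_id z).sub_const 0).pow 2).neg.div_const (2 * ((1 : NNReal) : ℝ))
    refine this.congr_deriv ?_
    simp
    ring
  refine (h.exp.const_mul (√(2 * Real.pi * ((1 : NNReal) : ℝ)))⁻¹).congr_deriv ?_
  rw [gaussianPDFReal]
  ring

/-- Gaussian integration by parts. -/
theorem integral_mul_id_gaussianReal {g g' : ℝ → ℝ} (hg : ∀ z, HasDerivAt g (g' z) z)
    (hc : Continuous g') {K K' : ℝ} (hK : ∀ y, |g y| ≤ K) (hK' : ∀ y, |g' y| ≤ K') :
    ∫ z, g z * z ∂(gaussianReal 0 1) = ∫ z, g' z ∂(gaussianReal 0 1) := by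
  have hgc : Continuous g := continuous_iff_continuousAt.2 fun y => (hg y).continuousAt
  have h1 : Integrable g (gaussianReal 0 1) := by
    simpa using integrable_of_abs_le hgc hK 0 1
  have h2 : Integrable g' (gaussianReal 0 1) := by
    simpa using integrable_of_abs_le hc hK' 0 1
  have h3 : Integrable (fun z => g z * z) (gaussianReal 0 1) :=
    integrable_id_gaussianReal.bdd_mul hgc.aestronglyMeasurable (Filter.Eventually.of_forall hK)
  have h := integral_mul_deriv_eq_deriv_mul_of_integrable
    (fun z _ => hg z) (fun z _ => hasDerivAt_gaussianPDFReal z)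
    (by
      refine (integrable_pdf_mul h3).neg.congr (Filter.Eventually.of_forall fun z => ?_)
      simp only [Pi.neg_apply, Pi.mul_apply]
      ring)
    (by
      refine (integrable_pdf_mul h2).congr (Filter.Eventually.of_forall fun z => ?_)
      simp only [Pi.mul_apply]
      ring)
    (by
      refine (integrable_pdf_mul h1).congr (Filter.Eventually.of_forall fun z => ?_)
      simp only [Pi.mul_apply]
      ring)
  rw [integral_gaussianReal_eq_integral_smul one_ne_zero,
    integral_gaussianReal_eq_integral_smul one_ne_zero]
  simp only [smul_eq_mul]
  have h4 : ∀ z, gaussianPDFReal 0 1 z * (g z * z) = -(g z * -(gaussianPDFReal 0 1 z * z)) :=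
    fun z => by ring
  simp only [h4, integral_neg, h, neg_neg]
  exact integral_congr_ae (Filter.Eventually.of_forall fun z => mul_comm _ _)

/-- The Gaussian average solves the heat equation: differentiate under the integral in time, then
integrate by parts. -/
theorem hasDerivAt_gaussAvg_time {f f' f'' : ℝ → ℝ} (hf : ∀ y, HasDerivAt f (f' y) y)
    (hf' : ∀ y, HasDerivAt f' (f'' y) y) (hc : Continuous f'') {K K' K'' : ℝ}
    (hK : ∀ y, |f y| ≤ K) (hK' : ∀ y, |f' y| ≤ K') (hK'' : ∀ y, |f'' y| ≤ K'') {t : ℝ}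
    (ht : 0 < t) (x : ℝ) :
    HasDerivAt (fun τ => gaussAvg f τ x) (1 / 2 * gaussAvg f'' t x) t := by
  have hfc : Continuous f := continuous_iff_continuousAt.2 fun y => (hf y).continuousAt
  have hfc' : Continuous f' := continuous_iff_continuousAt.2 fun y => (hf' y).continuousAt
  have hK0 : 0 ≤ K' := (abs_nonneg _).trans (hK' 0)
  have hst : 0 < √t := Real.sqrt_pos.2 ht
  have h := (hasDerivAt_integral_of_dominated_loc_of_deriv_le (μ := gaussianReal 0 1)
    (F := fun τ z => f (x + √τ * z)) (F' := fun τ z => f' (x + √τ * z) * (1 / (2 * √τ) * z))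
    (bound := fun z => K' * (1 / (2 * √(t / 2)) * |z|)) (x₀ := t) (s := Set.Ioi (t / 2))
    (Ioi_mem_nhds (by linarith)) ?_ (integrable_of_abs_le hfc hK _ _) ?_ ?_ ?_ ?_).2
  · refine h.congr_deriv ?_
    have hparts := integral_mul_id_gaussianReal (g := fun z => f' (x + √t * z))
      (g' := fun z => f'' (x + √t * z) * √t)
      (fun z => by
        have h1 : HasDerivAt (fun z : ℝ => x + √t * z) √t z := by
          simpa using ((hasDerivAt_id z).const_mul √t).const_add x
        exact (hf' _).comp z h1)
      (by fun_prop) (K := K') (K' := K'' * √t) (fun z => hK' _) (fun z => by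
        rw [abs_mul, abs_of_pos hst]
        exact mul_le_mul_of_nonneg_right (hK'' _) hst.le)
    have h2 : ∀ z, f' (x + √t * z) * (1 / (2 * √t) * z) =
        1 / (2 * √t) * (f' (x + √t * z) * z) := fun z => by ring
    simp only [h2]
    rw [integral_const_mul, hparts, integral_mul_const, gaussAvg]
    field_simp
  · exact Filter.Eventually.of_forall fun τ => Continuous.aestronglyMeasurable (by fun_prop)
  · exact Continuous.aestronglyMeasurable (by fun_prop)
  · refine Filter.Eventually.of_forall fun z τ hτ => ?_
    have hτ' : t / 2 < τ := hτ
    have h1 : √(t / 2) ≤ √τ := Real.sqrt_le_sqrt hτ'.le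
    have h2 : 0 < √(t / 2) := Real.sqrt_pos.2 (by linarith)
    rw [Real.norm_eq_abs, abs_mul, abs_mul, abs_of_nonneg (by positivity : 0 ≤ 1 / (2 * √τ))]
    have := hK' (x + √τ * z)
    gcongr
  · exact (integrable_id_gaussianReal.abs.const_mul _).const_mul _
  · refine Filter.Eventually.of_forall fun z τ hτ => ?_
    have hτ0 : τ ≠ 0 := by
      have : t / 2 < τ := hτ
      linarith
    have h1 : HasDerivAt (fun τ : ℝ => x + √τ * z) (1 / (2 * √τ) * z) τ :=
      ((Real.hasDerivAt_sqrt hτ0).mul_const z).const_add x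
    exact (hf _).comp τ h1

/-- The semigroup property, from the addition of independent Gaussian variables. -/
theorem gaussAvg_add {f : ℝ → ℝ} (hf : Continuous f) {K : ℝ} (hK : ∀ y, |f y| ≤ K) {t h : ℝ}
    (ht : 0 ≤ t) (hh : 0 ≤ h) (x : ℝ) :
    gaussAvg (gaussAvg f t) h x = gaussAvg f (t + h) x := by
  have hlaw : ∀ (τ : ℝ) (_ : 0 ≤ τ) (g : ℝ → ℝ) (_ : Continuous g) (y : ℝ), gaussAvg g τ y =
      ∫ a, g (y + a) ∂(gaussianReal 0 τ.toNNReal) := fun τ hτ g hg y => by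
    have hm : (gaussianReal 0 1).map (√τ * ·) = gaussianReal 0 τ.toNNReal := by
      rw [gaussianReal_map_const_mul]
      congr 1
      · simp
      · apply NNReal.coe_injective
        rw [mul_one, NNReal.coe_mk, Real.sq_sqrt hτ, Real.coe_toNNReal _ hτ]
    rw [← hm, integral_map (by fun_prop) (Continuous.aestronglyMeasurable (by fun_prop))]
    rfl
  have hg : Continuous (gaussAvg f t) :=
    (continuous_gaussAvg hf hK).comp (continuous_const.prodMk continuous_id)
  have hsum : gaussianReal 0 (t + h).toNNReal =
      (gaussianReal 0 h.toNNReal).conv (gaussianReal 0 t.toNNReal) := by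
    rw [gaussianReal_conv_gaussianReal, add_zero, Real.toNNReal_add ht hh, add_comm]
  have hint : Integrable (fun a => f (x + a))
      ((gaussianReal 0 h.toNNReal).conv (gaussianReal 0 t.toNNReal)) := by
    rw [← hsum]
    exact (memLp_two_of_bounded (by fun_prop) fun z => hK _).integrable one_le_two
  rw [hlaw h hh _ hg, hlaw (t + h) (add_nonneg ht hh) f hf, hsum, integral_conv hint]
  simp only [hlaw t ht f hf, add_assoc]

end GaussianAverage

/-! ### Uniqueness for the periodic heat equation -/

section HeatEquation

theorem exists_mem_Icc_of_periodic {f : ℝ → ℝ} (hf : Function.Periodic f 1) (x : ℝ) :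
    ∃ y ∈ Set.Icc (0 : ℝ) 1, f x = f y := by
  obtain ⟨y, hy, h⟩ := hf.exists_mem_Ico₀ one_pos x
  exact ⟨y, Set.Ico_subset_Icc_self hy, h⟩

theorem exists_abs_le_of_periodic {f : ℝ → ℝ} (hf : Function.Periodic f 1) (hc : Continuous f) :
    ∃ K, ∀ x, |f x| ≤ K := by
  obtain ⟨K, hK⟩ := (isCompact_Icc (a := (0 : ℝ)) (b := 1)).bddAbove_image hc.abs.continuousOn
  refine ⟨K, fun x => ?_⟩
  obtain ⟨y, hy, h⟩ := exists_mem_Icc_of_periodic hf x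
  rw [h]
  exact hK ⟨y, hy, rfl⟩

theorem iteratedDeriv_two_nonpos_of_isMax {h : ℝ → ℝ} (hh : ContDiff ℝ 2 h) {x : ℝ}
    (hx : ∀ y, h y ≤ h x) : iteratedDeriv 2 h x ≤ 0 := by
  have hmax : IsLocalMax h x := Filter.Eventually.of_forall hx
  rw [iteratedDeriv_succ, iteratedDeriv_one]
  by_contra! hpos
  have hmin := isLocalMin_of_deriv_deriv_pos hpos hmax.deriv_eq_zero hh.continuous.continuousAt
  -- A maximum that is also a local minimum makes the function locally constant.
  have hconst : h =ᶠ[nhds x] fun _ => h x := by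
    filter_upwards [hmin] with y hy
    exact le_antisymm (hx y) hy
  have h0 : deriv (deriv h) x = 0 := by
    rw [hconst.deriv.deriv_eq]
    simp
  exact hpos.ne' h0

/-- The weak maximum principle. Subtracting `ε t` makes the value at an interior maximum
contradict the equation. -/
theorem IsPeriodicHeatSolution.nonpos {u₀ : ℝ → ℝ} {u : ℝ → ℝ → ℝ}
    (hu : IsPeriodicHeatSolution u₀ u) (h0 : ∀ x, u₀ x ≤ 0) {t : ℝ} (ht : 0 ≤ t) (x : ℝ) :
    u t x ≤ 0 := by
  by_contra! hpos
  have ht0 : 0 < t := by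
    refine ht.lt_of_ne ?_
    rintro rfl
    rw [hu.initial] at hpos
    exact absurd (h0 x) (not_le.2 hpos)
  set ε : ℝ := u t x / (2 * t) with hε
  have hε0 : 0 < ε := by positivity
  obtain ⟨x', hx', hxx'⟩ := exists_mem_Icc_of_periodic (hu.periodic t ht) x
  have hcont : ContinuousOn (fun q : ℝ × ℝ => u q.1 q.2 - ε * q.1)
      (Set.Icc 0 t ×ˢ Set.Icc (0 : ℝ) 1) :=
    (hu.continuousOn.mono (Set.prod_mono (fun s hs => hs.1) (Set.subset_univ _))).sub
      (by fun_prop)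
  obtain ⟨⟨t₁, x₁⟩, ⟨ht₁, hx₁⟩, hmax⟩ := (isCompact_Icc.prod isCompact_Icc).exists_isMaxOn
    ⟨(t, x'), ⟨ht, le_rfl⟩, hx'⟩ hcont
  have hmax' : ∀ s ∈ Set.Icc 0 t, ∀ y, u s y - ε * s ≤ u t₁ x₁ - ε * t₁ := fun s hs y => by
    obtain ⟨y', hy', hyy'⟩ := exists_mem_Icc_of_periodic (hu.periodic s hs.1) y
    rw [hyy']
    exact hmax (show (s, y') ∈ Set.Icc 0 t ×ˢ Set.Icc (0 : ℝ) 1 from ⟨hs, hy'⟩)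
  have hval : 0 < u t₁ x₁ - ε * t₁ := by
    have h1 := hmax' t ⟨ht, le_rfl⟩ x
    have h2 : ε * t = u t x / 2 := by
      rw [hε]
      field_simp
    linarith
  have ht₁0 : 0 < t₁ := by
    refine ht₁.1.lt_of_ne ?_
    rintro rfl
    rw [hu.initial] at hval
    have := h0 x₁
    linarith
  have hxx : iteratedDeriv 2 (u t₁) x₁ ≤ 0 :=
    iteratedDeriv_two_nonpos_of_isMax (hu.contDiff t₁ ht₁0) fun y => by
      have := hmax' t₁ ht₁ y
      linarith
  have hder : HasDerivAt (fun s => u s x₁ - ε * s)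
      (1 / 2 * iteratedDeriv 2 (u t₁) x₁ - ε) t₁ :=
    ((hu.heat t₁ ht₁0 x₁).sub ((hasDerivAt_id t₁).const_mul ε)).congr_deriv (by rw [mul_one])
  have hneg : 1 / 2 * iteratedDeriv 2 (u t₁) x₁ - ε < 0 := by linarith
  have hslope := ((hasDerivAt_iff_tendsto_slope.1 hder).eventually_lt_const hneg).filter_mono
    (nhdsWithin_mono t₁ fun s (hs : s ∈ Set.Iio t₁) => ne_of_lt hs)
  obtain ⟨s, hs, hs0, hst⟩ := (hslope.and (Ioo_mem_nhdsLT ht₁0)).exists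
  rw [slope_def_field, div_neg_iff] at hs
  have h3 := hmax' s ⟨hs0.le, hst.le.trans ht₁.2⟩ x₁
  rcases hs with hs | hs
  · linarith [hs.1]
  · linarith [hs.2]

theorem IsPeriodicHeatSolution.sub {u₀ v₀ : ℝ → ℝ} {u v : ℝ → ℝ → ℝ}
    (hu : IsPeriodicHeatSolution u₀ u) (hv : IsPeriodicHeatSolution v₀ v) :
    IsPeriodicHeatSolution (u₀ - v₀) fun t => u t - v t where
  initial x := by simp [hu.initial, hv.initial]
  periodic t ht := (hu.periodic t ht).sub (hv.periodic t ht)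
  continuousOn := hu.continuousOn.sub hv.continuousOn
  contDiff t ht := (hu.contDiff t ht).sub (hv.contDiff t ht)
  heat t ht x := by
    rw [iteratedDeriv_sub (hu.contDiff t ht).contDiffAt (hv.contDiff t ht).contDiffAt, mul_sub]
    exact (hu.heat t ht x).sub (hv.heat t ht x)

theorem IsPeriodicHeatSolution.unique {u₀ : ℝ → ℝ} {u v : ℝ → ℝ → ℝ}
    (hu : IsPeriodicHeatSolution u₀ u) (hv : IsPeriodicHeatSolution u₀ v) {t : ℝ} (ht : 0 ≤ t)
    (x : ℝ) : u t x = v t x := by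
  have h1 := (hu.sub hv).nonpos (fun x => by simp) ht x
  have h2 := (hv.sub hu).nonpos (fun x => by simp) ht x
  simp only [Pi.sub_apply] at h1 h2
  linarith

theorem periodic_deriv {f : ℝ → ℝ} (hf : Function.Periodic f 1) :
    Function.Periodic (deriv f) 1 := fun x => by
  rw [← deriv_comp_add_const]
  congr 1
  exact funext hf

variable {f : ℝ → ℝ}

theorem hasDerivAt_deriv_of_contDiff_two (hf : ContDiff ℝ 2 f) (x : ℝ) :
    HasDerivAt f (deriv f x) x :=
  ((hf.differentiable two_ne_zero) x).hasDerivAt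

theorem hasDerivAt_iteratedDeriv_two (hf : ContDiff ℝ 2 f) (x : ℝ) :
    HasDerivAt (deriv f) (iteratedDeriv 2 f x) x := by
  rw [iteratedDeriv_succ, iteratedDeriv_one]
  have h : ContDiff ℝ 1 (deriv f) :=
    (contDiff_succ_iff_deriv (n := 1) (f := f)).1 (by simpa [one_add_one_eq_two] using hf) |>.2.2
  exact ((h.differentiable one_ne_zero) x).hasDerivAt

theorem periodic_iteratedDeriv_two (hp : Function.Periodic f 1) :
    Function.Periodic (iteratedDeriv 2 f) 1 := by
  rw [iteratedDeriv_succ, iteratedDeriv_one]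
  exact periodic_deriv (periodic_deriv hp)

theorem deriv_gaussAvg (hf : ContDiff ℝ 2 f) (hp : Function.Periodic f 1) (t : ℝ) :
    (∀ x, HasDerivAt (gaussAvg f t) (gaussAvg (deriv f) t x) x) ∧
      ∀ x, HasDerivAt (gaussAvg (deriv f) t) (gaussAvg (iteratedDeriv 2 f) t x) x := by
  have hc1 : Continuous (deriv f) := hf.continuous_deriv one_le_two
  have hc2 : Continuous (iteratedDeriv 2 f) := hf.continuous_iteratedDeriv 2 le_rfl
  obtain ⟨K, hK⟩ := exists_abs_le_of_periodic hp hf.continuous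
  obtain ⟨K', hK'⟩ := exists_abs_le_of_periodic (periodic_deriv hp) hc1
  obtain ⟨K'', hK''⟩ := exists_abs_le_of_periodic (periodic_iteratedDeriv_two hp) hc2
  exact ⟨hasDerivAt_gaussAvg (hasDerivAt_deriv_of_contDiff_two hf) hc1 hK hK' t,
    hasDerivAt_gaussAvg (hasDerivAt_iteratedDeriv_two hf) hc2 hK' hK'' t⟩

theorem iteratedDeriv_two_gaussAvg (hf : ContDiff ℝ 2 f) (hp : Function.Periodic f 1) (t : ℝ) :
    iteratedDeriv 2 (gaussAvg f t) = gaussAvg (iteratedDeriv 2 f) t := by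
  obtain ⟨h1, h2⟩ := deriv_gaussAvg hf hp t
  rw [iteratedDeriv_succ, iteratedDeriv_one, funext fun x => (h1 x).deriv]
  exact funext fun x => (h2 x).deriv

theorem contDiff_gaussAvg (hf : ContDiff ℝ 2 f) (hp : Function.Periodic f 1) (t : ℝ) :
    ContDiff ℝ 2 (gaussAvg f t) := by
  obtain ⟨h1, h2⟩ := deriv_gaussAvg hf hp t
  have hc2 : Continuous (iteratedDeriv 2 f) := hf.continuous_iteratedDeriv 2 le_rfl
  obtain ⟨K'', hK''⟩ := exists_abs_le_of_periodic (periodic_iteratedDeriv_two hp) hc2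
  have h3 : ContDiff ℝ 1 (gaussAvg (deriv f) t) := by
    rw [contDiff_one_iff_deriv]
    refine ⟨fun x => (h2 x).differentiableAt, ?_⟩
    rw [funext fun x => (h2 x).deriv]
    exact (continuous_gaussAvg hc2 hK'').comp (continuous_const.prodMk continuous_id)
  rw [← one_add_one_eq_two, contDiff_succ_iff_deriv]
  refine ⟨fun x => (h1 x).differentiableAt, by simp, ?_⟩
  rwa [funext fun x => (h1 x).deriv]

theorem isPeriodicHeatSolution_gaussAvg (hf : ContDiff ℝ 2 f) (hp : Function.Periodic f 1) :
    IsPeriodicHeatSolution f (gaussAvg f) := by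
  have hc1 : Continuous (deriv f) := hf.continuous_deriv one_le_two
  have hc2 : Continuous (iteratedDeriv 2 f) := hf.continuous_iteratedDeriv 2 le_rfl
  obtain ⟨K, hK⟩ := exists_abs_le_of_periodic hp hf.continuous
  obtain ⟨K', hK'⟩ := exists_abs_le_of_periodic (periodic_deriv hp) hc1
  obtain ⟨K'', hK''⟩ := exists_abs_le_of_periodic (periodic_iteratedDeriv_two hp) hc2
  refine ⟨gaussAvg_zero f, fun t _ => gaussAvg_periodic hp t,
    (continuous_gaussAvg hf.continuous hK).continuousOn, fun t _ => contDiff_gaussAvg hf hp t,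
    fun t ht x => ?_⟩
  rw [iteratedDeriv_two_gaussAvg hf hp]
  exact hasDerivAt_gaussAvg_time (hasDerivAt_deriv_of_contDiff_two hf)
    (hasDerivAt_iteratedDeriv_two hf) hc2 hK hK' hK'' ht x

end HeatEquation

/-! ### The error of the averaged scheme -/

section AveragedError

variable {f : ℝ → ℝ}

theorem abs_sub_taylor_le (hf : ContDiff ℝ 2 f) {K : ℝ} (hK : ∀ x, |iteratedDeriv 2 f x| ≤ K)
    (x y : ℝ) : |f y - f x - deriv f x * (y - x)| ≤ K * (y - x) ^ 2 := by
  have hK0 : 0 ≤ K := (abs_nonneg _).trans (hK 0)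
  have h1 : ∀ z, |deriv f z - deriv f x| ≤ K * |z - x| := fun z => by
    have := convex_univ.norm_image_sub_le_of_norm_hasDerivWithin_le (f := deriv f)
      (f' := iteratedDeriv 2 f) (C := K) (x := x) (y := z)
      (fun z _ => (hasDerivAt_iteratedDeriv_two hf z).hasDerivWithinAt) (fun z _ => hK z)
      (Set.mem_univ _) (Set.mem_univ _)
    simpa using this
  have h2 := (convex_uIcc x y).norm_image_sub_le_of_norm_hasDerivWithin_le
    (f := fun z => f z - deriv f x * z) (f' := fun z => deriv f z - deriv f x) (C := K * |y - x|)
    (fun z _ => (((hasDerivAt_deriv_of_contDiff_two hf z).sub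
      ((hasDerivAt_id z).const_mul (deriv f x))).congr_deriv (by rw [mul_one])).hasDerivWithinAt)
    (fun z hz => (h1 z).trans (mul_le_mul_of_nonneg_left (Set.abs_sub_left_of_mem_uIcc hz) hK0))
    Set.left_mem_uIcc Set.right_mem_uIcc
  have h3 : f y - f x - deriv f x * (y - x) =
      f y - deriv f x * y - (f x - deriv f x * x) := by ring
  rw [h3, ← sq_abs, sq, ← mul_assoc]
  exact h2

variable {M : ℕ} [NeZero M]

theorem gridValues_residue (hp : Function.Periodic f 1) (l : ℤ) :
    gridValues M f (residue M l) = f (l * dx M) := by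
  obtain ⟨i, hi⟩ := exists_node_residue (M := M) l
  rw [gridValues, hi]
  simpa using hp.int_mul i (l * dx M)

theorem abs_interp_gridValues_sub_le (hf : ContDiff ℝ 2 f) (hp : Function.Periodic f 1) {K : ℝ}
    (hK : ∀ x, |iteratedDeriv 2 f x| ≤ K) (x : ℝ) :
    |f x - interp (gridValues M f) x| ≤ K * dx M ^ 2 := by
  have hK0 : 0 ≤ K := (abs_nonneg _).trans (hK 0)
  obtain ⟨l, θ, h0, h1, rfl⟩ := exists_cell M x
  rw [interp_apply _ l h0 h1, gridValues_residue hp, gridValues_residue hp]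
  set x := ((l : ℝ) + θ) * dx M
  set a := (l : ℝ) * dx M
  set b := ((l + 1 : ℤ) : ℝ) * dx M
  have ha : a - x = -(θ * dx M) := by simp only [a, x]; ring
  have hb : b - x = (1 - θ) * dx M := by simp only [b, x]; push_cast; ring
  have h2 := abs_le.1 (abs_sub_taylor_le hf hK x a)
  have h3 := abs_le.1 (abs_sub_taylor_le hf hK x b)
  rw [ha] at h2
  rw [hb] at h3
  have hθ : 0 ≤ 1 - θ := by linarith
  have hw : (1 - θ) * (K * (-(θ * dx M)) ^ 2) + θ * (K * ((1 - θ) * dx M) ^ 2) ≤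
      K * dx M ^ 2 := by
    have : (1 - θ) * (K * (-(θ * dx M)) ^ 2) + θ * (K * ((1 - θ) * dx M) ^ 2) =
        (K * dx M ^ 2) * (θ * (1 - θ)) := by ring
    rw [this]
    exact mul_le_of_le_one_right (by positivity) (by nlinarith)
  have e1 := mul_le_mul_of_nonneg_left h2.1 hθ
  have e2 := mul_le_mul_of_nonneg_left h2.2 hθ
  have e3 := mul_le_mul_of_nonneg_left h3.1 h0
  have e4 := mul_le_mul_of_nonneg_left h3.2 h0
  rw [abs_le]
  constructor <;> linarith

/-- One step of length `δt` creates an interpolation error of order `δx²`, and the averaged step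
does not amplify the errors made before it. -/
theorem abs_gaussAvg_sub_meanScheme_le (hf : ContDiff ℝ 2 f) (hp : Function.Periodic f 1) {K : ℝ}
    (hK : ∀ x, |iteratedDeriv 2 f x| ≤ K) {δt : ℝ} (hδ : 0 < δt) (n : ℕ) (j : Fin M) :
    |gaussAvg f (n * δt) (node j) - meanScheme δt (gridValues M f) n j| ≤
      n * (K * dx M ^ 2) := by
  obtain ⟨K₀, hK₀⟩ := exists_abs_le_of_periodic hp hf.continuous
  induction n generalizing j with
  | zero => simp [gaussAvg_zero, meanScheme, gridValues]
  | succ n ih =>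
    set g := gaussAvg f (n * δt) with hg
    have hg2 : ContDiff ℝ 2 g := contDiff_gaussAvg hf hp _
    have hgK : ∀ x, |iteratedDeriv 2 g x| ≤ K := fun x => by
      rw [hg, iteratedDeriv_two_gaussAvg hf hp]
      exact abs_gaussAvg_le hK _ _
    have hstep : gaussAvg f ((n + 1 : ℕ) * δt) (node j) =
        ∫ z, g (node j + √δt * z) ∂(gaussianReal 0 1) := by
      have h := gaussAvg_add hf.continuous hK₀ (t := n * δt) (h := δt) (by positivity) hδ.le
        (node j)
      rw [show ((n + 1 : ℕ) : ℝ) * δt = n * δt + δt by push_cast; ring, ← h]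
      rfl
    have hgi : Integrable (fun z => g (node j + √δt * z)) (gaussianReal 0 1) :=
      integrable_of_abs_le hg2.continuous (fun y => abs_gaussAvg_le hK₀ _ y) _ _
    have h1 : |∫ z, g (node j + √δt * z) ∂(gaussianReal 0 1) -
        avgStep √δt (gridValues M g) j| ≤ K * dx M ^ 2 := by
      rw [avgStep_apply, ← integral_sub hgi (integrable_interp _ _ _)]
      have h := norm_integral_le_of_norm_le_const (μ := gaussianReal 0 1)
        (f := fun z => g (node j + √δt * z) - interp (gridValues M g) (node j + √δt * z))
        (Filter.Eventually.of_forall fun z => abs_interp_gridValues_sub_le hg2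
          (gaussAvg_periodic hp _) hgK (node j + √δt * z))
      simpa using h
    have h2 : |avgStep √δt (gridValues M g - meanScheme δt (gridValues M f) n) j| ≤
        n * (K * dx M ^ 2) := abs_avgStep_le _ (fun k => ih k) j
    rw [map_sub, Pi.sub_apply] at h2
    rw [hstep, meanScheme_succ]
    refine (abs_sub_le _ (avgStep √δt (gridValues M g) j) _).trans ((add_le_add h1 h2).trans_eq ?_)
    push_cast
    ring

theorem abs_iteratedDeriv_two_le_iSup (hf : ContDiff ℝ 2 f) (hp : Function.Periodic f 1) (x : ℝ) :
    |iteratedDeriv 2 f x| ≤ ⨆ y : Set.Icc (0 : ℝ) 1, |iteratedDeriv 2 f y| := by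
  obtain ⟨K, hK⟩ := exists_abs_le_of_periodic (periodic_iteratedDeriv_two hp)
    (hf.continuous_iteratedDeriv 2 le_rfl)
  obtain ⟨y, hy, h⟩ := exists_mem_Icc_of_periodic (periodic_iteratedDeriv_two hp) x
  rw [h]
  refine le_ciSup (f := fun y : Set.Icc (0 : ℝ) 1 => |iteratedDeriv 2 f y|) ?_ ⟨y, hy⟩
  exact ⟨K, by rintro _ ⟨z, rfl⟩; exact hK z⟩

theorem averaged_error_le {T : ℝ} (hT : 0 < T) (hf : ContDiff ℝ 2 f) (hp : Function.Periodic f 1)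
    {u : ℝ → ℝ → ℝ} (hu : IsPeriodicHeatSolution f u) {MT : ℕ} (hMT : 1 ≤ MT) {n : ℕ}
    (hn : n ≤ MT) (j : Fin M) :
    |u (n * dt T MT) (node j) - meanScheme (dt T MT) (gridValues M f) n j| ≤
      T * (dx M ^ 2 / dt T MT) * ⨆ y : Set.Icc (0 : ℝ) 1, |iteratedDeriv 2 f y| := by
  have hδ := dt_pos hT hMT
  have hK := abs_iteratedDeriv_two_le_iSup hf hp
  set K := ⨆ y : Set.Icc (0 : ℝ) 1, |iteratedDeriv 2 f y|
  have hK0 : 0 ≤ K := (abs_nonneg _).trans (hK 0)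
  rw [hu.unique (isPeriodicHeatSolution_gaussAvg hf hp) (by positivity)]
  refine (abs_gaussAvg_sub_meanScheme_le hf hp hK hδ n j).trans ?_
  have h := natCast_mul_dt_le hT hMT hn
  have h1 : (n : ℝ) ≤ T / dt T MT := (le_div_iff₀ hδ).2 h
  calc (n : ℝ) * (K * dx M ^ 2) ≤ T / dt T MT * (K * dx M ^ 2) :=
        mul_le_mul_of_nonneg_right h1 (by positivity)
    _ = T * (dx M ^ 2 / dt T MT) * K := by ring

end AveragedError

end SemiLagrangian

theorem theorem1 (T : ℝ) (hT : 0 < T) :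
    (∃ C : ℝ, 0 < C ∧
      ∀ u₀ : ℝ → ℝ, ContDiff ℝ 2 u₀ → Function.Periodic u₀ 1 →
      ∀ u : ℝ → ℝ → ℝ, SemiLagrangian.IsPeriodicHeatSolution u₀ u →
      ∀ (MS MT : ℕ), 1 ≤ MS → 1 ≤ MT → ∀ n : ℕ, n ≤ MT →
        (⨆ j : Fin MS,
          |u ((n : ℝ) * SemiLagrangian.dt T MT) (SemiLagrangian.node j) -
            SemiLagrangian.meanScheme (SemiLagrangian.dt T MT)
              (SemiLagrangian.gridValues MS u₀) n j|)
        ≤ C * (SemiLagrangian.dx MS ^ 2 / SemiLagrangian.dt T MT) *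
            ⨆ x : Set.Icc (0 : ℝ) 1, |iteratedDeriv 2 u₀ x|) ∧
    (∀ p : ℕ, ∃ C : ℝ, 0 < C ∧
      ∀ u₀ : ℝ → ℝ, ContDiff ℝ 2 u₀ → Function.Periodic u₀ 1 →
      ∀ (MS MT N : ℕ) [NeZero MS], 1 ≤ MT → 1 ≤ N →
      ∀ (Ω : Type*) [MeasurableSpace Ω] (P : MeasureTheory.Measure Ω)
        [MeasureTheory.IsProbabilityMeasure P] (ξ : ℕ → Fin N → Fin MS → Ω → ℝ),
      SemiLagrangian.IsGaussianNoise P MT ξ → ∀ n : ℕ, n ≤ MT →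
        let δx : ℝ := SemiLagrangian.dx MS
        let δt : ℝ := SemiLagrangian.dt T MT
        let w₀ : Fin MS → ℝ := SemiLagrangian.gridValues MS u₀
        let err : Ω → ℝ := fun ω =>
          SemiLagrangian.ell2NormSq
            (SemiLagrangian.mcScheme δt w₀ (fun i m j => ξ i m j ω) n -
              SemiLagrangian.meanScheme δt w₀ n)
        MeasureTheory.Integrable err P ∧
        ∫ ω, err ω ∂P ≤
          C * SemiLagrangian.h1SeminormSq w₀ * (1 + δx ^ 2 / δt) *
            (1 + δx / δt + δx ^ 2 / δt ^ 2 * (1 + |Real.log δt|)) ^ p *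
            (δt / (N : ℝ) + 1 / (N : ℝ) ^ (p + 1))) := by
  refine ⟨⟨T, hT, ?_⟩, fun p => ⟨SemiLagrangian.errorConst T p,
    SemiLagrangian.errorConst_pos hT.le p, ?_⟩⟩
  · intro u₀ hf hp u hu MS MT hMS hMT n hn
    have : NeZero MS := ⟨by omega⟩
    exact ciSup_le fun j => SemiLagrangian.averaged_error_le hT hf hp hu hMT hn j
  · intro u₀ _ _ MS MT N _ hMT hN Ω _ P _ ξ hG n hn δx δt w₀ err
    obtain ⟨hint, hle⟩ := SemiLagrangian.monteCarlo_error_le hT p hMT hN hG w₀ hn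
    refine ⟨hint, hle.trans ?_⟩
    have hx : 0 < δx := SemiLagrangian.dx_pos
    have ht : 0 < δt := SemiLagrangian.dt_pos hT hMT
    have hB := (zero_le_one.trans (SemiLagrangian.one_le_ratioFactor hx ht))
    have hC := (SemiLagrangian.errorConst_pos hT.le p).le
    -- The argument does not need the factor `1 + δx² / δt`, which is at least `1`.
    have hfac : 1 ≤ 1 + δx ^ 2 / δt := le_add_of_nonneg_right (by positivity)
    have hH : 0 ≤ SemiLagrangian.h1SeminormSq w₀ := by
      rw [SemiLagrangian.h1SeminormSq_eq]
      have := SemiLagrangian.gradSq_nonneg w₀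
      positivity
    exact mul_le_mul_of_nonneg_right (mul_le_mul_of_nonneg_right
      (le_mul_of_one_le_right (mul_nonneg hC hH) hfac) (pow_nonneg hB p)) (by positivity)
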